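/- **Commutativity of Gaudin $T$-operators.** Let $N,n\ge 0$ be integers, $x_1,\dots,x_n\in\mathbb C$ (not necessarily distinct) and let $h$ be any complex $N\times N$ matrix (the twist matrix). Let $e_{ab}$ be the matrix units, and $e^{(i)}_{ab}=\mathbb I^{\otimes(i-1)}\otimes e_{ab}\otimes \mathbb I^{\otimes(n-i)}$ acting on $(\mathbb C^N)^{\otimes n}$. For a function $F$ of an $N\times N$ matrix with values in $\mathrm{End}((\mathbb C^N)^{\otimes n})$ put $$\mathsf d_iF(h)=\frac{\partial}{\partial\varepsilon}\sum_{a,b=1}^N e^{(i)}_{ab}\,F(h+\varepsilon e_{ba})\Big|_{\varepsilon=0},$$ and for a scalar function $f$ let $(\alpha_n+\beta_n\mathsf d_n)\cdots(\alpha_1+\beta_1\mathsf d_1)f(h)$ denote the operator obtained by applying the factors, that of site $1$ first, to the function $h\mapsto f(h)\,\mathbb I$. Then all the following hold. 1. Let $w(z)=\det(\mathbb I-zh)^{-1}$, so that $w(z)/w(\zeta)=\det(\mathbb I-\zeta h)/\det(\mathbb I-zh)$. For all $y_1,\dots,y_n\in\mathbb C$ and all $z_1,\zeta_1,z_2,\zeta_2\in\mathbb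 C$ with $\det(\mathbb I-z_1h)\ne0$ and $\det(\mathbb I-z_2h)\neq 0$, the operators $$(y_n+\mathsf d_n)\cdots(y_1+\mathsf d_1)\frac{w(z_1)}{w(\zeta_1)}\quad\text{and}\quad (y_n+\mathsf d_n)\cdots(y_1+\mathsf d_1)\frac{w(z_2)}{w(\zeta_2)}$$ commute. 2. Let $f,\tilde f$ be finite linear combinations of characters of finite-dimensional polynomial representations of $GL(N,\mathbb C)$, regarded as polynomial functions on all $N\times N$ matrices. For all $x,x'\in\mathbb C$ the operators $(x-x_n+\mathsf d_n)\cdots(x-x_1+\mathsf d_1)f(h)$ and $(x'-x_n+\mathsf d_n)\cdots(x'-x_1+\mathsf d_1)\tilde f(h)$ commute. If $x,x'\notin\{x_1,\dots,x_n\}$, then the operators $\bigl(1+\frac{\mathsf d_n}{x-x_n}\bigr)\cdots\bigl(1+\frac{\mathsf d_1}{x-x_1}\bigr)f(h)$ and $\bigl(1+\frac{\mathsf d_n}{x'-x_n}\bigr)\cdots\bigl(1+\frac{\mathsf d_1}{x'-x_1}\bigr)\tilde f(h)$ commute as well. 3. For a Young diagram $\lambda$ with $\ell(\lambda)$ rows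 let $\chi_\lambda(h)=\det_{1\le i,j\le\ell(\lambda)}h_{\lambda_i-i+j}(h)$, where $\sum_{k\ge0}h_k(h)z^k=\det(\mathbb I-zh)^{-1}$ and $h_k=0$ for $k<0$. For all Young diagrams $\lambda,\mu$ and all $x,x'$, the transfer matrices $T^G_\lambda(x)=(x-x_n+\mathsf d_n)\cdots(x-x_1+\mathsf d_1)\chi_\lambda(h)$ and $T^G_\mu(x')$ commute; if $x,x'\notin\{x_1,\dots,x_n\}$, so do $\mathsf T^G_\lambda(x)=\bigl(1+\frac{\mathsf d_n}{x-x_n}\bigr)\cdots\bigl(1+\frac{\mathsf d_1}{x-x_1}\bigr)\chi_\lambda(h)$ and $\mathsf T^G_\mu(x')$. 4. Let $\mathbf t=(t_k)_{k\ge1}$ and $\mathbf t'=(t'_k)_{k\ge1}$ be complex sequences such that $\sum_k|t_k|r^k<\infty$ and $\sum_k|t'_k|r^k<\infty$ for some real $r$ larger than the modulus of every eigenvalue of $h$ (for example, sequences with finitely many nonzero terms). Then for all $x,x'\in\mathbb C$ the master $T$-operators $$T^G(x,\mathbf t)=(x-x_n+\mathsf d_n)\cdots(x-x_1+\mathsf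 d_1)\exp\Bigl(\sum_{k\ge1}t_k\,\mathrm{tr}\,h^k\Bigr)$$ and $T^G(x',\mathbf t')$ commute: $[T^G(x,\mathbf t),T^G(x',\mathbf t')]=0$. -/

import Mathlib

open Matrix

namespace Gaudin

noncomputable section

/-- Operators on the quantum space `(ℂ^N)^{⊗ n}`, written as matrices in the product basis
`e_{s 0} ⊗ ⋯ ⊗ e_{s (n-1)}`, which is indexed by `s : Fin n → Fin N`. -/
abbrev Op (N n : ℕ) := Matrix (Fin n → Fin N) (Fin n → Fin N) ℂ

/-- `e_{ab}^{(i)} = 1 ⊗ ⋯ ⊗ e_{ab} ⊗ ⋯ ⊗ 1`, with the matrix unit `e_{ab}` at the site `i`. -/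
def siteUnit {N n : ℕ} (i : Fin n) (a b : Fin N) : Op N n :=
  Matrix.of fun s t => if s i = a ∧ t i = b ∧ ∀ j, j ≠ i → s j = t j then 1 else 0

/-- The matrix derivative at the site `i`:
`(d_i F)(h) = ∂/∂ε ∑_{a,b} e_{ab}^{(i)} F(h + ε e_{ba}) |_{ε = 0}`, with complex `ε`;
the derivative is taken entry by entry. -/
def coderiv {N n : ℕ} (i : Fin n) (F : Matrix (Fin N) (Fin N) ℂ → Op N n) :
    Matrix (Fin N) (Fin N) ℂ → Op N n :=
  fun h => ∑ a, ∑ b, siteUnit i a b *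
    Matrix.of fun s t => deriv (fun ε : ℂ => F (h + ε • Matrix.single b a 1) s t) 0

/-- The product `(α_n + β_n d_n) ⋯ (α_1 + β_1 d_1) f`; the factor of the first site acts first. -/
def prodOp {N n : ℕ} (α β : Fin n → ℂ) (f : Matrix (Fin N) (Fin N) ℂ → ℂ) :
    Matrix (Fin N) (Fin N) ℂ → Op N n :=
  (List.finRange n).foldl (fun F i h => α i • F h + β i • coderiv i F h)
    (fun h => f h • (1 : Op N n))

/-- `(x - x_n + d_n) ⋯ (x - x_1 + d_1) f`, the polynomial normalization. -/
def gaudinOp {N n : ℕ} (xs : Fin n → ℂ) (x : ℂ) (f : Matrix (Fin N) (Fin N) ℂ → ℂ) :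
    Matrix (Fin N) (Fin N) ℂ → Op N n :=
  prodOp (fun i => x - xs i) (fun _ => 1) f

/-- `(1 + d_n / (x - x_n)) ⋯ (1 + d_1 / (x - x_1)) f`, the rational normalization
(meaningful for `x` different from all `x_i`). -/
def gaudinOpRat {N n : ℕ} (xs : Fin n → ℂ) (x : ℂ) (f : Matrix (Fin N) (Fin N) ℂ → ℂ) :
    Matrix (Fin N) (Fin N) ℂ → Op N n :=
  prodOp (fun _ => 1) (fun i => 1 / (x - xs i)) f

/-- `w(z) = det(1 - z h)⁻¹` as a function of `h`. -/
def w {N : ℕ} (z : ℂ) (h : Matrix (Fin N) (Fin N) ℂ) : ℂ :=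
  ((1 - z • h).det)⁻¹

/-- A finite-dimensional polynomial representation of `GL(N, ℂ)`, in coordinates: the matrix
entries of the representation are polynomials in the entries of the group element. -/
structure PolynomialRep (N : ℕ) where
  dim : ℕ
  toHom : GL (Fin N) ℂ →* Matrix (Fin dim) (Fin dim) ℂ
  entry : Fin dim → Fin dim → MvPolynomial (Fin N × Fin N) ℂ
  eval_entry : ∀ (g : GL (Fin N) ℂ) (i j : Fin dim),
    MvPolynomial.eval (fun p => (g : Matrix (Fin N) (Fin N) ℂ) p.1 p.2) (entry i j) = toHom g i j

/-- The character of a polynomial representation, as a function on all `N × N` matrices: the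
polynomial function whose value at `g ∈ GL(N, ℂ)` is the trace of `g` in the representation. -/
def PolynomialRep.character {N : ℕ} (ρ : PolynomialRep N) (h : Matrix (Fin N) (Fin N) ℂ) : ℂ :=
  ∑ i, MvPolynomial.eval (fun p => h p.1 p.2) (ρ.entry i i)

/-- Finite linear combinations of characters of polynomial representations of `GL(N, ℂ)`. -/
def classFunctions (N : ℕ) : Submodule ℂ (Matrix (Fin N) (Fin N) ℂ → ℂ) :=
  Submodule.span ℂ (Set.range (PolynomialRep.character (N := N)))

/-- The complete homogeneous symmetric function `h_k` of the eigenvalues of `g`, zero for `k < 0`: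
`∑_{k ≥ 0} h_k z^k = exp (∑_{k ≥ 1} tr(g^k) z^k / k) = 1 / det(1 - z g)`;
`Matrix.charpolyRev g` is the polynomial `det(1 - z g)` in `z`. -/
def completeSymm {N : ℕ} (k : ℤ) (g : Matrix (Fin N) (Fin N) ℂ) : ℂ :=
  if k < 0 then 0
  else PowerSeries.coeff k.toNat ((g.charpolyRev : PowerSeries ℂ)⁻¹)

/-- The character `χ_lam` of the representation with highest weight `lam`, by the Jacobi-Trudi formula
`χ_lam = det_{1 ≤ i, j ≤ ℓ(lam)} h_{lam_i - i + j}`. -/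
def schurCharacter {N : ℕ} (lam : YoungDiagram) (g : Matrix (Fin N) (Fin N) ℂ) : ℂ :=
  Matrix.det (Matrix.of fun i j : Fin (lam.colLen 0) =>
    completeSymm ((lam.rowLen i : ℤ) - (i : ℤ) + (j : ℤ)) g)

/-- `exp (∑_{k ≥ 1} t_k tr h^k)`. -/
def masterFunction {N : ℕ} (t : ℕ+ → ℂ) (h : Matrix (Fin N) (Fin N) ℂ) : ℂ :=
  Complex.exp (∑' k : ℕ+, t k * (h ^ (k : ℕ)).trace)

/-- The master `T`-operator `T^G(x, t)`. -/
def masterT {N n : ℕ} (xs : Fin n → ℂ) (x : ℂ) (t : ℕ+ → ℂ)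
    (h : Matrix (Fin N) (Fin N) ℂ) : Op N n :=
  gaudinOp xs x (masterFunction t) h

end

end Gaudin

/-! Only two properties of the scalar function $f$ matter: invariance under conjugation and
analyticity at $h$. Matrix derivatives at different sites do not interact, so the matrix element of
$\prod_i(y_i+\mathsf d_i)f$ between $s$ and $t$ is the constant-coefficient operator with symbol
$\prod_i(y_i\delta_{s_it_i}+X_{t_is_i})$ applied to $f$ at $h$ (`prodOp_apply`).

Suppose the $x_i$ are distinct and $y_i=x-x_i$. Every such operator commutes with the Gaudin
Hamiltonians $H_i=h^{(i)}+\sum_{j\ne i}P_{ij}/(x_i-x_j)$, which depend neither on $f$ nor on $x$.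
Differentiating the infinitesimal invariance of $f$ expresses the commutator with $h^{(i)}$ as a sum
of pair terms over $j\ne i$ (`commutator_siteMat`). The commutator with $P_{ij}$ is
$y_i-y_j=x_j-x_i$ times the same pair term (`commutator_swapMat`). The two cancel in
`commute_hamiltonian_symbolOp`.

Two operators commuting with one matrix that has a cyclic vector commute with each other
(`commute_of_krylov`). After $h$ is replaced by $h+\varepsilon\,\mathrm{diag}(0,\dots,N-1)$, the
combination $\sum_iN^iH_i$ (sites counted from $0$) has a cyclic vector for all small
$\varepsilon\ne0$. Letting $\varepsilon\to0$ proves the claim for distinct $x_i$, and a second limit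
in the $x_i$ removes distinctness (`commute_prodOp`). It remains to verify invariance and
analyticity for the four families; only the master function needs real work, through Gelfand's
formula. -/

namespace Gaudin

noncomputable section

/-! ### Directional derivatives and coordinate multiplications on analytic functions -/

section AnalyticFunctions

variable {E : Type*} [NormedAddCommGroup E] [NormedSpace ℂ E]

/-- Functions that are analytic on `U` and vanish outside `U`. -/
def analyticFun (U : Set E) : Submodule ℂ (E → ℂ) where
  carrier := {f | AnalyticOnNhd ℂ f U ∧ ∀ x ∉ U, f x = 0}
  add_mem' := fun hf hg => ⟨hf.1.add hg.1, fun x hx => by simp [hf.2 x hx, hg.2 x hx]⟩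
  zero_mem' := ⟨analyticOnNhd_const, fun _ _ => rfl⟩
  smul_mem' := fun c f hf =>
    ⟨(analyticOnNhd_const (v := c)).smul hf.1, fun x hx => by simp [hf.2 x hx]⟩

variable {U : Set E}

theorem differentiableAt_analyticFun (f : analyticFun U) {x : E} (hx : x ∈ U) :
    DifferentiableAt ℂ (f : E → ℂ) x :=
  (f.2.1 x hx).differentiableAt

theorem analyticOnNhd_indicator (hU : IsOpen U) {f : E → ℂ} (hf : AnalyticOnNhd ℂ f U) :
    AnalyticOnNhd ℂ (U.indicator f) U :=
  hf.congr hU fun _ hx => (Set.indicator_of_mem hx f).symm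

/-- The function `f` on `U`, extended by zero. -/
def analyticFun.restrict (hU : IsOpen U) (f : E → ℂ) (hf : AnalyticOnNhd ℂ f U) : analyticFun U :=
  ⟨U.indicator f, analyticOnNhd_indicator hU hf, fun _ hx => Set.indicator_of_notMem hx f⟩

theorem analyticFun.restrict_apply (hU : IsOpen U) (f : E → ℂ) (hf : AnalyticOnNhd ℂ f U)
    {x : E} (hx : x ∈ U) : (analyticFun.restrict hU f hf : E → ℂ) x = f x :=
  Set.indicator_of_mem hx f

/-- The convention of value zero off `U` serves this: it makes the derivatives honest endomorphisms
of one module, so that operator identities need checking only on `U`. -/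
theorem analyticFun.ext_on {f g : analyticFun U} (h : ∀ x ∈ U, (f : E → ℂ) x = (g : E → ℂ) x) :
    f = g := by
  apply Subtype.ext
  funext x
  by_cases hx : x ∈ U
  · exact h x hx
  · rw [f.2.2 x hx, g.2.2 x hx]

theorem analyticOnNhd_fderiv_apply (v : E) (f : analyticFun U) :
    AnalyticOnNhd ℂ (fun x => fderiv ℂ (f : E → ℂ) x v) U := fun x hx =>
  ((ContinuousLinearMap.apply ℂ ℂ v).analyticAt _).comp (f.2.1 x hx).fderiv

/-- The derivative in the direction `v`, on functions analytic on an open set. -/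
def dirDeriv (hU : IsOpen U) (v : E) : Module.End ℂ (analyticFun U) where
  toFun f := analyticFun.restrict hU (fun x => fderiv ℂ (f : E → ℂ) x v)
    (analyticOnNhd_fderiv_apply v f)
  map_add' f g := analyticFun.ext_on fun x hx => by
    change _ = (analyticFun.restrict hU _ _ : E → ℂ) x + (analyticFun.restrict hU _ _ : E → ℂ) x
    iterate 3 rw [analyticFun.restrict_apply hU _ _ hx]
    rw [Submodule.coe_add, fderiv_add (differentiableAt_analyticFun f hx) (differentiableAt_analyticFun g hx)]
    rfl
  map_smul' c f := analyticFun.ext_on fun x hx => by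
    change _ = c • (analyticFun.restrict hU _ _ : E → ℂ) x
    iterate 2 rw [analyticFun.restrict_apply hU _ _ hx]
    rw [Submodule.coe_smul, fderiv_const_smul (differentiableAt_analyticFun f hx)]
    rfl

theorem dirDeriv_apply (hU : IsOpen U) (v : E) (f : analyticFun U) {x : E} (hx : x ∈ U) :
    (dirDeriv hU v f : E → ℂ) x = fderiv ℂ (f : E → ℂ) x v :=
  analyticFun.restrict_apply hU _ (analyticOnNhd_fderiv_apply v f) hx

theorem deriv_line_eq_dirDeriv (hU : IsOpen U) (v : E) (f : analyticFun U) {F : E → ℂ}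
    (hF : ∀ x ∈ U, F x = (f : E → ℂ) x) {x : E} (hx : x ∈ U) :
    deriv (fun ε : ℂ => F (x + ε • v)) 0 = (dirDeriv hU v f : E → ℂ) x := by
  have h1 : F =ᶠ[nhds x] (f : E → ℂ) :=
    Filter.eventuallyEq_of_mem (hU.mem_nhds hx) hF
  have h2 : DifferentiableAt ℂ F x := (differentiableAt_analyticFun f hx).congr_of_eventuallyEq h1
  rw [dirDeriv_apply hU v f hx, ← h1.fderiv_eq]
  exact h2.lineDeriv_eq_fderiv

theorem dirDeriv_comm (hU : IsOpen U) (v v' : E) :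
    Commute (dirDeriv hU v) (dirDeriv hU v') := by
  have key : ∀ (u u' : E) (f : analyticFun U) (x : E), x ∈ U →
      (dirDeriv hU u (dirDeriv hU u' f) : E → ℂ) x
        = fderiv ℂ (fderiv ℂ (f : E → ℂ)) x u u' := by
    intro u u' f x hx
    rw [dirDeriv_apply hU _ _ hx]
    have h1 : (dirDeriv hU u' f : E → ℂ) =ᶠ[nhds x] fun z => fderiv ℂ (f : E → ℂ) z u' :=
      Filter.eventuallyEq_of_mem (hU.mem_nhds hx) fun z hz => dirDeriv_apply hU u' f hz
    rw [h1.fderiv_eq, fderiv_clm_apply (f.2.1 x hx).fderiv.differentiableAt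
      (differentiableAt_const _)]
    simp
  refine LinearMap.ext fun f => analyticFun.ext_on fun x hx => ?_
  change (dirDeriv hU v (dirDeriv hU v' f) : E → ℂ) x = (dirDeriv hU v' (dirDeriv hU v f) : E → ℂ) x
  rw [key v v' f x hx, key v' v f x hx]
  have hs : ContDiffAt ℂ ⊤ (f : E → ℂ) x := (f.2.1 x hx).contDiffAt
  exact (hs.isSymmSndFDerivAt (by simp)).eq v v'

/-- Multiplication by a continuous linear functional. -/
def mulFunctional (U : Set E) (l : E →L[ℂ] ℂ) : Module.End ℂ (analyticFun U) where
  toFun f := ⟨fun x => l x * (f : E → ℂ) x,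
    fun x hx => (l.analyticAt x).mul (f.2.1 x hx), fun x hx => by simp [f.2.2 x hx]⟩
  map_add' f g := Subtype.ext (funext fun x => mul_add _ _ _)
  map_smul' c f := Subtype.ext (funext fun x => mul_left_comm _ _ _)

theorem mulFunctional_apply (l : E →L[ℂ] ℂ) (f : analyticFun U) (x : E) :
    (mulFunctional U l f : E → ℂ) x = l x * (f : E → ℂ) x := rfl

/-- The Weyl relation, which is the product rule for a linear factor. -/
theorem dirDeriv_mulFunctional (hU : IsOpen U) (v : E) (l : E →L[ℂ] ℂ) :
    dirDeriv hU v * mulFunctional U l = mulFunctional U l * dirDeriv hU v + l v • 1 := by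
  refine LinearMap.ext fun f => analyticFun.ext_on fun x hx => ?_
  change (dirDeriv hU v (mulFunctional U l f) : E → ℂ) x
    = l x * (dirDeriv hU v f : E → ℂ) x + l v * (f : E → ℂ) x
  rw [dirDeriv_apply hU v _ hx, dirDeriv_apply hU v _ hx]
  change fderiv ℂ (fun x => l x * (f : E → ℂ) x) x v = _
  rw [fderiv_fun_mul l.differentiableAt (differentiableAt_analyticFun f hx)]
  simp [mul_comm]

end AnalyticFunctions

open scoped IsMulCommutative in
-- Polynomial evaluation needs a commutative target; the subalgebra generated by the commuting
-- elements provides one.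
theorem exists_algHom_of_commute {σ R : Type*} [Ring R] [Algebra ℂ R] (d : σ → R)
    (hd : ∀ i j, Commute (d i) (d j)) :
    ∃ φ : MvPolynomial σ ℂ →ₐ[ℂ] R, ∀ i, φ (MvPolynomial.X i) = d i := by
  have : IsMulCommutative (Algebra.adjoin ℂ (Set.range d)) := Algebra.isMulCommutative_adjoin ℂ (by
    rintro _ ⟨i, rfl⟩ _ ⟨j, rfl⟩
    exact hd i j)
  refine ⟨(Algebra.adjoin ℂ (Set.range d)).val.comp
    (MvPolynomial.aeval fun i =>
      (⟨d i, Algebra.subset_adjoin ⟨i, rfl⟩⟩ : Algebra.adjoin ℂ (Set.range d))), fun i => ?_⟩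
  simp

/-! ### Constant-coefficient differential operators and their symbols -/

section PolyDiff

variable {E : Type*} [NormedAddCommGroup E] [NormedSpace ℂ E] {U : Set E} {σ : Type*}

/-- The differential operator with constant coefficients attached to a polynomial; the variable
`X i` acts as the derivative in the direction `v i`. -/
def polyDiff (hU : IsOpen U) (v : σ → E) : MvPolynomial σ ℂ →ₐ[ℂ] Module.End ℂ (analyticFun U) :=
  (exists_algHom_of_commute (fun i => dirDeriv hU (v i)) fun _ _ => dirDeriv_comm hU _ _).choose

theorem polyDiff_X (hU : IsOpen U) (v : σ → E) (i : σ) :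
    polyDiff hU v (MvPolynomial.X i) = dirDeriv hU (v i) :=
  (exists_algHom_of_commute (fun i => dirDeriv hU (v i))
    fun _ _ => dirDeriv_comm hU _ _).choose_spec i

/-- Moving a coordinate through $q(\partial)$ differentiates the symbol; this is the Weyl relation
extended by induction on $q$. -/
theorem polyDiff_mulFunctional [DecidableEq σ] (hU : IsOpen U) (v : σ → E) (i : σ)
    (l : E →L[ℂ] ℂ) (hl : ∀ j, l (v j) = if j = i then 1 else 0) (q : MvPolynomial σ ℂ) :
    polyDiff hU v q * mulFunctional U l
      = mulFunctional U l * polyDiff hU v q + polyDiff hU v (MvPolynomial.pderiv i q) := by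
  induction q using MvPolynomial.induction_on with
  | C a =>
    rw [MvPolynomial.pderiv_C, map_zero, add_zero, MvPolynomial.algHom_C]
    exact Algebra.commutes a _
  | add p q hp hq => simp only [map_add, add_mul, mul_add, hp, hq]; abel
  | mul_X p j hp =>
    rw [map_mul, polyDiff_X, mul_assoc, dirDeriv_mulFunctional, mul_add, ← mul_assoc, hp, hl,
      Derivation.leibniz, MvPolynomial.pderiv_X]
    by_cases hj : j = i
    · subst hj
      simp only [if_true, Pi.single_eq_same, smul_eq_mul, mul_one, one_smul, map_add, map_mul,
        polyDiff_X, mul_comm (MvPolynomial.X j), add_mul, mul_assoc]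
      abel
    · rw [if_neg hj, Pi.single_eq_of_ne hj]
      simp only [smul_eq_mul, mul_zero, zero_smul, add_zero, zero_add, map_mul,
        polyDiff_X, mul_comm (MvPolynomial.X j), add_mul, mul_assoc]

end PolyDiff

end

end Gaudin

namespace Gaudin

noncomputable section

attribute [local instance] Matrix.linftyOpNormedRing Matrix.linftyOpNormedAlgebra

/-- The topology of the operator norm, in a form that unifies with the normed structure. -/
abbrev matrixTopology (N : ℕ) : TopologicalSpace (Matrix (Fin N) (Fin N) ℂ) :=
  (inferInstance : PseudoMetricSpace (Matrix (Fin N) (Fin N) ℂ)).toUniformSpace.toTopologicalSpace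

attribute [local instance] matrixTopology

/-! ### Matrices acting at one tensor factor -/

section SiteMatrices

variable {N n : ℕ}

/-- The matrix `X` acting at the site `i`. -/
def siteMat (i : Fin n) (X : Matrix (Fin N) (Fin N) ℂ) : Op N n :=
  Matrix.of fun s t => if ∀ k, k ≠ i → s k = t k then X (s i) (t i) else 0

theorem sum_update_eq (i : Fin n) (s : Fin n → Fin N) (g : (Fin n → Fin N) → ℂ) :
    ∑ u, (if ∀ k, k ≠ i → s k = u k then g u else 0)
      = ∑ c, g (Function.update s i c) := by
  rw [← Finset.sum_filter]
  symm
  refine Finset.sum_bij (fun c _ => Function.update s i c) (fun c _ => ?_) (fun c _ d _ h => ?_)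
    (fun u hu => ⟨u i, Finset.mem_univ _, ?_⟩) fun _ _ => rfl
  · simp only [Finset.mem_filter, Finset.mem_univ, true_and]
    intro k hk
    rw [Function.update_of_ne hk]
  · exact Function.update_injective s i h
  · funext k
    by_cases hk : k = i
    · subst hk; simp
    · rw [Function.update_of_ne hk]
      exact (Finset.mem_filter.1 hu).2 k hk

theorem siteMat_mul_apply (i : Fin n) (X : Matrix (Fin N) (Fin N) ℂ) (D : Op N n)
    (s t : Fin n → Fin N) :
    (siteMat i X * D) s t = ∑ c, X (s i) c * D (Function.update s i c) t := by
  have := sum_update_eq i s fun u => X (s i) (u i) * D u t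
  simp only [Function.update_self] at this
  rw [← this, Matrix.mul_apply]
  refine Finset.sum_congr rfl fun u _ => ?_
  simp only [siteMat, Matrix.of_apply, ite_mul, zero_mul]

theorem mul_siteMat_apply (i : Fin n) (X : Matrix (Fin N) (Fin N) ℂ) (D : Op N n)
    (s t : Fin n → Fin N) :
    (D * siteMat i X) s t = ∑ c, D s (Function.update t i c) * X c (t i) := by
  have := sum_update_eq i t fun u => D s u * X (u i) (t i)
  simp only [Function.update_self] at this
  rw [← this, Matrix.mul_apply]
  refine Finset.sum_congr rfl fun u _ => ?_
  simp only [siteMat, Matrix.of_apply, mul_ite, mul_zero, eq_comm]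

theorem siteUnit_eq_siteMat (i : Fin n) (a b : Fin N) :
    siteUnit i a b = siteMat i (Matrix.single a b 1) := by
  ext s t
  simp only [siteUnit, siteMat, Matrix.of_apply, Matrix.single_apply, ← ite_and]
  congr 1
  simp only [eq_iff_iff, eq_comm (a := a), eq_comm (a := b)]
  tauto

end SiteMatrices

/-! ### Matrix elements of the $T$-operators as differential operators -/

section Symbols

variable {N n : ℕ} {U : Set (Matrix (Fin N) (Fin N) ℂ)}

/-- The differential operator with constant coefficients in the entries of a matrix. -/
abbrev entryDiff (hU : IsOpen U) :
    MvPolynomial (Fin N × Fin N) ℂ →ₐ[ℂ] Module.End ℂ (analyticFun U) :=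
  polyDiff hU fun p => Matrix.single p.1 p.2 (1 : ℂ)

/-- The unit $e_{ab}$ at site `i` forces `a = s i` and changes the row index there to `b`; the
matching direction $e_{ba}$ is the variable `X (b, s i)`. -/
theorem coderiv_apply (hU : IsOpen U) (i : Fin n) (F : Matrix (Fin N) (Fin N) ℂ → Op N n)
    (G : (Fin n → Fin N) → (Fin n → Fin N) → analyticFun U)
    (hG : ∀ h ∈ U, ∀ s t, F h s t = (G s t : Matrix (Fin N) (Fin N) ℂ → ℂ) h)
    {h : Matrix (Fin N) (Fin N) ℂ} (hh : h ∈ U) (s t : Fin n → Fin N) :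
    coderiv i F h s t = ((∑ b, entryDiff hU (MvPolynomial.X (b, s i))
      (G (Function.update s i b) t) : analyticFun U) : Matrix (Fin N) (Fin N) ℂ → ℂ) h := by
  simp only [coderiv, Matrix.sum_apply, siteUnit_eq_siteMat, siteMat_mul_apply, Matrix.of_apply,
    Matrix.single_apply, AddSubmonoidClass.coe_finsetSum, Finset.sum_apply, polyDiff_X]
  rw [Finset.sum_comm]
  refine Finset.sum_congr rfl fun b _ => ?_
  rw [Finset.sum_eq_single (s i), Finset.sum_eq_single b]
  · rw [if_pos ⟨rfl, rfl⟩, one_mul]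
    exact deriv_line_eq_dirDeriv hU _ _ (fun x hx => hG x hx _ _) hh
  · intro c _ hc
    rw [if_neg fun h => hc h.2.symm, zero_mul]
  · simp
  · intro a _ ha
    refine Finset.sum_eq_zero fun c _ => ?_
    rw [if_neg fun h => ha h.1, zero_mul]
  · simp

/-- The symbol of the factor `α_i + β_i d_i`, between the basis vectors `s` and `t`. -/
def siteSymbol (α β : Fin n → ℂ) (s t : Fin n → Fin N) (i : Fin n) :
    MvPolynomial (Fin N × Fin N) ℂ :=
  MvPolynomial.C (if s i = t i then α i else 0) + MvPolynomial.C (β i) * MvPolynomial.X (t i, s i)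

/-- Induction from the end of the list, since the last factor is outermost. Sites not yet treated
carry the identity, so the sum over `b` in the derivative at the new site collapses to `b = t i`.
Distinctness of the sites keeps the earlier factors unaffected by the update at `i`. -/
theorem foldl_coderiv_apply (hU : IsOpen U) (α β : Fin n → ℂ)
    (f : Matrix (Fin N) (Fin N) ℂ → ℂ) (hf : AnalyticOnNhd ℂ f U) (L : List (Fin n))
    (hL : L.Nodup) (h : Matrix (Fin N) (Fin N) ℂ) (hh : h ∈ U) (s t : Fin n → Fin N) :
    (L.foldl (fun F i h => α i • F h + β i • coderiv i F h)
      (fun h => f h • (1 : Op N n))) h s t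
    = ((if ∀ k, k ∉ L → s k = t k then
        entryDiff hU (L.map (siteSymbol α β s t)).prod (analyticFun.restrict hU f hf) else 0 :
          analyticFun U) : Matrix (Fin N) (Fin N) ℂ → ℂ) h := by
  induction L using List.reverseRecOn generalizing h s t with
  | nil =>
    simp only [List.foldl_nil, Matrix.smul_apply, Matrix.one_apply, List.not_mem_nil,
      not_false_eq_true, forall_const, ← funext_iff]
    split_ifs
    · simp [analyticFun.restrict_apply hU f hf hh]
    · simp
  | append_singleton L i ih =>
    obtain ⟨hL, hi⟩ : L.Nodup ∧ i ∉ L := by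
      rw [List.nodup_append] at hL
      exact ⟨hL.1, fun h => hL.2.2 i h i (by simp) rfl⟩
    rw [List.foldl_append, List.foldl_cons, List.foldl_nil]
    simp only [Matrix.add_apply, Matrix.smul_apply]
    rw [coderiv_apply hU i _ _ (fun h hh s t => ih hL h hh s t) hh s t, ih hL h hh s t,
      Finset.sum_eq_single (t i)]
    · have hmap : L.map (siteSymbol α β (Function.update s i (t i)) t)
          = L.map (siteSymbol α β s t) := by
        refine List.map_congr_left fun k hk => ?_
        have hki : k ≠ i := fun h => hi (h ▸ hk)
        simp only [siteSymbol, Function.update_of_ne hki]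
      rw [hmap]
      have hc : (∀ k, k ∉ L → Function.update s i (t i) k = t k)
          ↔ ∀ k, k ∉ L ++ [i] → s k = t k := by
        refine forall_congr' fun k => ?_
        by_cases hki : k = i
        · subst hki; simp
        · simp [hki]
      have hc' : (∀ k, k ∉ L → s k = t k)
          ↔ (∀ k, k ∉ L ++ [i] → s k = t k) ∧ s i = t i := by
        constructor
        · exact fun H => ⟨fun k hk => H k fun h => hk (List.mem_append_left _ h), H i hi⟩
        · rintro ⟨H, H'⟩ k hk
          by_cases hki : k = i
          · rw [hki, H']
          · exact H k (by simp [hk, hki])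
      rw [if_congr hc rfl rfl, if_congr hc' rfl rfl]
      by_cases H : ∀ k, k ∉ L ++ [i] → s k = t k
      · rw [if_pos H, if_pos H]
        simp only [List.map_append, List.map_cons, List.map_nil,
          List.prod_append, List.prod_singleton]
        rw [mul_comm _ (siteSymbol α β s t i), siteSymbol, add_mul, map_add, map_mul, map_mul,
          map_mul, MvPolynomial.algHom_C, MvPolynomial.algHom_C]
        by_cases hst : s i = t i
        · rw [if_pos ⟨H, hst⟩]
          simp [hst]
        · rw [if_neg fun h => hst h.2]
          simp [hst]
      · rw [if_neg H, if_neg H, if_neg fun h => H h.1]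
        simp
    · intro b _ hb
      rw [if_neg, map_zero]
      intro H
      apply hb
      simpa using H i hi
    · simp

theorem prodOp_apply (hU : IsOpen U) (α β : Fin n → ℂ) (f : Matrix (Fin N) (Fin N) ℂ → ℂ)
    (hf : AnalyticOnNhd ℂ f U) {h : Matrix (Fin N) (Fin N) ℂ} (hh : h ∈ U)
    (s t : Fin n → Fin N) :
    prodOp α β f h s t = (entryDiff hU (∏ i, siteSymbol α β s t i)
      (analyticFun.restrict hU f hf) : Matrix (Fin N) (Fin N) ℂ → ℂ) h := by
  rw [prodOp, foldl_coderiv_apply hU α β f hf _ (List.nodup_finRange n) h hh s t, if_pos,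
    ← List.ofFn_eq_map, List.prod_ofFn]
  exact fun k hk => absurd (List.mem_finRange k) hk

end Symbols

end

end Gaudin

namespace Gaudin

noncomputable section

attribute [local instance] Matrix.linftyOpNormedRing Matrix.linftyOpNormedAlgebra
attribute [local instance] matrixTopology

/-! ### Infinitesimal conjugation invariance -/

section Invariance

variable {N : ℕ} {U : Set (Matrix (Fin N) (Fin N) ℂ)}

/-- Invariance under conjugation with invertible matrices. -/
def ConjInvariant (f : Matrix (Fin N) (Fin N) ℂ → ℂ) : Prop :=
  ∀ A B : Matrix (Fin N) (Fin N) ℂ, IsUnit A → f (A * B) = f (B * A)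

/-- Differentiate $f((1+tX)h)=f(h(1+tX))$ at $t=0$; the factor $1+tX$ is invertible for small $t$.
-/
theorem ConjInvariant.fderiv_mul_comm {f : Matrix (Fin N) (Fin N) ℂ → ℂ} (hf : ConjInvariant f)
    {h : Matrix (Fin N) (Fin N) ℂ} (hd : DifferentiableAt ℂ f h) (X : Matrix (Fin N) (Fin N) ℂ) :
    fderiv ℂ f h (X * h) = fderiv ℂ f h (h * X) := by
  rw [← hd.lineDeriv_eq_fderiv, ← hd.lineDeriv_eq_fderiv]
  apply Filter.EventuallyEq.deriv_eq
  have hc : Continuous fun t : ℂ => (1 : Matrix (Fin N) (Fin N) ℂ) + t • X := by fun_prop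
  have hu : ∀ᶠ t : ℂ in nhds 0, IsUnit ((1 : Matrix (Fin N) (Fin N) ℂ) + t • X) :=
    hc.continuousAt.eventually (Units.isOpen.mem_nhds (by simp))
  filter_upwards [hu] with t ht
  have := hf _ h ht
  simpa [add_mul, mul_add] using this

/-- The matrix entry `h ↦ h a b` as a continuous linear functional. -/
def entryFunctional (a b : Fin N) : Matrix (Fin N) (Fin N) ℂ →L[ℂ] ℂ :=
  LinearMap.toContinuousLinearMap (Matrix.entryLinearMap ℂ ℂ a b)

theorem entryFunctional_apply (a b : Fin N) (h : Matrix (Fin N) (Fin N) ℂ) :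
    entryFunctional a b h = h a b := rfl

theorem single_mul_eq_sum (h : Matrix (Fin N) (Fin N) ℂ) (a b : Fin N) :
    Matrix.single b a (1 : ℂ) * h = ∑ c, h a c • Matrix.single b c (1 : ℂ) := by
  ext i j
  rw [Matrix.sum_apply, Matrix.mul_apply, Finset.sum_eq_single a, Finset.sum_eq_single j]
  · by_cases hb : b = i <;> simp [hb]
  · intro c _ hc
    simp [hc]
  · simp
  · intro c _ hc
    simp [hc.symm]
  · simp

theorem mul_single_eq_sum (h : Matrix (Fin N) (Fin N) ℂ) (a b : Fin N) :
    h * Matrix.single b a (1 : ℂ) = ∑ c, h c b • Matrix.single c a (1 : ℂ) := by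
  ext i j
  rw [Matrix.sum_apply, Matrix.mul_apply, Finset.sum_eq_single b, Finset.sum_eq_single i]
  · by_cases hb : a = j <;> simp [hb]
  · intro c _ hc
    simp [hc]
  · simp
  · intro c _ hc
    simp [hc.symm]
  · simp

theorem sum_mul_dirDeriv_eq (hU : IsOpen U) (f : Matrix (Fin N) (Fin N) ℂ → ℂ)
    (hf : AnalyticOnNhd ℂ f U) (hinv : ConjInvariant f) (a b : Fin N) :
    ∑ c, mulFunctional U (entryFunctional a c)
        (entryDiff hU (MvPolynomial.X (b, c)) (analyticFun.restrict hU f hf))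
      = ∑ c, mulFunctional U (entryFunctional c b)
        (entryDiff hU (MvPolynomial.X (c, a)) (analyticFun.restrict hU f hf)) := by
  refine analyticFun.ext_on fun h hh => ?_
  simp only [AddSubmonoidClass.coe_finsetSum, Finset.sum_apply, mulFunctional_apply,
    polyDiff_X, dirDeriv_apply hU _ _ hh, entryFunctional_apply]
  have h1 : ((analyticFun.restrict hU f hf : analyticFun U) : Matrix (Fin N) (Fin N) ℂ → ℂ)
      =ᶠ[nhds h] f :=
    Filter.eventuallyEq_of_mem (hU.mem_nhds hh) fun x hx => analyticFun.restrict_apply hU f hf hx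
  rw [h1.fderiv_eq]
  have := hinv.fderiv_mul_comm (hf h hh).differentiableAt (Matrix.single b a (1 : ℂ))
  rw [single_mul_eq_sum, mul_single_eq_sum] at this
  simpa only [map_sum, map_smul, smul_eq_mul] using this

/-- The value at `h` of the derivatives of `f`, as a functional of the symbol. -/
def jetFunctional (hU : IsOpen U) (f : Matrix (Fin N) (Fin N) ℂ → ℂ) (hf : AnalyticOnNhd ℂ f U)
    (h : Matrix (Fin N) (Fin N) ℂ) : MvPolynomial (Fin N × Fin N) ℂ →ₗ[ℂ] ℂ where
  toFun q := (entryDiff hU q (analyticFun.restrict hU f hf) : Matrix (Fin N) (Fin N) ℂ → ℂ) h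
  map_add' p q := by rw [map_add]; rfl
  map_smul' c q := by rw [map_smul]; rfl

theorem jetFunctional_mul (hU : IsOpen U) (f : Matrix (Fin N) (Fin N) ℂ → ℂ)
    (hf : AnalyticOnNhd ℂ f U) (h : Matrix (Fin N) (Fin N) ℂ)
    (p q : MvPolynomial (Fin N × Fin N) ℂ) :
    jetFunctional hU f hf h (p * q) = (entryDiff hU p (entryDiff hU q
      (analyticFun.restrict hU f hf)) : Matrix (Fin N) (Fin N) ℂ → ℂ) h := by
  rw [← Module.End.mul_apply, ← map_mul]
  rfl

theorem entryDiff_mulFunctional (hU : IsOpen U) (q : MvPolynomial (Fin N × Fin N) ℂ)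
    (a b : Fin N) (g : analyticFun U) :
    entryDiff hU q (mulFunctional U (entryFunctional a b) g)
      = mulFunctional U (entryFunctional a b) (entryDiff hU q g)
        + entryDiff hU (MvPolynomial.pderiv (a, b) q) g := by
  refine DFunLike.congr_fun (polyDiff_mulFunctional hU _ (a, b) (entryFunctional a b) ?_ q) g
  rintro ⟨c, d⟩
  simp [entryFunctional_apply, Matrix.single_apply]

/-- Apply $q(\partial)$ to the first-order equation `sum_mul_dirDeriv_eq` and move the entries of
$h$ to the left; each passage leaves a derivative of $q$. -/
theorem jetFunctional_invariance (hU : IsOpen U) (f : Matrix (Fin N) (Fin N) ℂ → ℂ)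
    (hf : AnalyticOnNhd ℂ f U) (hinv : ConjInvariant f) (h : Matrix (Fin N) (Fin N) ℂ)
    (q : MvPolynomial (Fin N × Fin N) ℂ) (a b : Fin N) :
    ∑ c, (h a c * jetFunctional hU f hf h (q * MvPolynomial.X (b, c))
        + jetFunctional hU f hf h (MvPolynomial.pderiv (a, c) q * MvPolynomial.X (b, c)))
      = ∑ c, (h c b * jetFunctional hU f hf h (q * MvPolynomial.X (c, a))
        + jetFunctional hU f hf h (MvPolynomial.pderiv (c, b) q * MvPolynomial.X (c, a))) := by
  have := congrArg (fun g => (entryDiff hU q g : Matrix (Fin N) (Fin N) ℂ → ℂ) h)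
    (sum_mul_dirDeriv_eq hU f hf hinv a b)
  simp only [map_sum, entryDiff_mulFunctional, AddSubmonoidClass.coe_finsetSum,
    Finset.sum_apply] at this
  simp only [jetFunctional_mul]
  exact this

end Invariance

end

end Gaudin

namespace Gaudin

noncomputable section

/-! ### Gaudin Hamiltonians and their commutators with the $T$-operators -/

section Hamiltonians

variable {N n : ℕ}

/-- The permutation of the tensor factors `i` and `j`. -/
def swapMat (i j : Fin n) : Op N n :=
  Matrix.of fun s t => if s ∘ Equiv.swap i j = t then 1 else 0

theorem swapMat_mul_apply (i j : Fin n) (D : Op N n) (s t : Fin n → Fin N) :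
    ((swapMat i j : Op N n) * D) s t = D (s ∘ Equiv.swap i j) t := by
  simp [Matrix.mul_apply, swapMat]

theorem mul_swapMat_apply (i j : Fin n) (D : Op N n) (s t : Fin n → Fin N) :
    (D * (swapMat i j : Op N n)) s t = D s (t ∘ Equiv.swap i j) := by
  have h : ∀ u : Fin n → Fin N, u ∘ Equiv.swap i j = t ↔ t ∘ Equiv.swap i j = u := by
    intro u
    constructor <;> rintro rfl <;> ext k <;> simp
  simp [Matrix.mul_apply, swapMat, h]

/-- The operator with the matrix elements `L (∏ (y_i δ + X (t i, s i)))`. -/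
def symbolOp (y : Fin n → ℂ) (L : MvPolynomial (Fin N × Fin N) ℂ →ₗ[ℂ] ℂ) : Op N n :=
  Matrix.of fun s t => L (∏ i, siteSymbol y (fun _ => 1) s t i)

theorem pderiv_prod {ι σ : Type*} [DecidableEq ι] (p : σ) (g : ι → MvPolynomial σ ℂ)
    (S : Finset ι) :
    MvPolynomial.pderiv p (∏ k ∈ S, g k)
      = ∑ j ∈ S, (∏ k ∈ S.erase j, g k) * MvPolynomial.pderiv p (g j) := by
  induction S using Finset.induction_on with
  | empty => simp
  | insert a S ha ih =>
    rw [Finset.prod_insert ha, Derivation.leibniz, ih, Finset.sum_insert ha,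
      Finset.erase_insert ha, smul_eq_mul, smul_eq_mul, Finset.mul_sum, add_comm]
    congr 1
    refine Finset.sum_congr rfl fun j hj => ?_
    have hja : j ≠ a := fun h => ha (h ▸ hj)
    rw [Finset.erase_insert_of_ne hja.symm,
      Finset.prod_insert fun h => ha (Finset.mem_of_mem_erase h), mul_assoc]

theorem pderiv_prod_siteSymbol (y : Fin n → ℂ) (s t : Fin n → Fin N) (S : Finset (Fin n))
    (a b : Fin N) :
    MvPolynomial.pderiv (a, b) (∏ k ∈ S, siteSymbol y (fun _ => 1) s t k)
      = ∑ j ∈ S, (∏ k ∈ S.erase j, siteSymbol y (fun _ => 1) s t k)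
        * (if t j = a ∧ s j = b then 1 else 0) := by
  rw [pderiv_prod]
  refine Finset.sum_congr rfl fun j _ => ?_
  rw [siteSymbol, map_add, MvPolynomial.pderiv_C, zero_add, map_one, one_mul,
    MvPolynomial.pderiv_X, Pi.single_apply]
  simp [eq_comm]

/-- The product of the factors of all sites except `i` and `j`. -/
def restSymbol (y : Fin n → ℂ) (s t : Fin n → Fin N) (i j : Fin n) :
    MvPolynomial (Fin N × Fin N) ℂ :=
  ∏ k ∈ (Finset.univ.erase i).erase j, siteSymbol y (fun _ => 1) s t k

theorem symbolOp_update_left (y : Fin n → ℂ) (L : MvPolynomial (Fin N × Fin N) ℂ →ₗ[ℂ] ℂ)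
    (s t : Fin n → Fin N) (i : Fin n) (c : Fin N) :
    symbolOp y L (Function.update s i c) t
      = (if c = t i then y i else 0) * L (∏ k ∈ Finset.univ.erase i, siteSymbol y (fun _ => 1) s t k)
        + L ((∏ k ∈ Finset.univ.erase i, siteSymbol y (fun _ => 1) s t k)
          * MvPolynomial.X (t i, c)) := by
  have : ∏ k ∈ Finset.univ.erase i, siteSymbol y (fun _ => 1) (Function.update s i c) t k
      = ∏ k ∈ Finset.univ.erase i, siteSymbol y (fun _ => 1) s t k :=
    Finset.prod_congr rfl fun k hk => by
      simp only [siteSymbol, Function.update_of_ne (Finset.ne_of_mem_erase hk)]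
  rw [symbolOp, Matrix.of_apply, ← Finset.mul_prod_erase _ _ (Finset.mem_univ i), this, mul_comm,
    siteSymbol, Function.update_self, mul_add, map_add, mul_comm _ (MvPolynomial.C _),
    ← MvPolynomial.smul_eq_C_mul, map_smul, smul_eq_mul, map_one, one_mul]

theorem symbolOp_update_right (y : Fin n → ℂ) (L : MvPolynomial (Fin N × Fin N) ℂ →ₗ[ℂ] ℂ)
    (s t : Fin n → Fin N) (i : Fin n) (c : Fin N) :
    symbolOp y L s (Function.update t i c)
      = (if s i = c then y i else 0) * L (∏ k ∈ Finset.univ.erase i, siteSymbol y (fun _ => 1) s t k)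
        + L ((∏ k ∈ Finset.univ.erase i, siteSymbol y (fun _ => 1) s t k)
          * MvPolynomial.X (c, s i)) := by
  have : ∏ k ∈ Finset.univ.erase i, siteSymbol y (fun _ => 1) s (Function.update t i c) k
      = ∏ k ∈ Finset.univ.erase i, siteSymbol y (fun _ => 1) s t k :=
    Finset.prod_congr rfl fun k hk => by
      simp only [siteSymbol, Function.update_of_ne (Finset.ne_of_mem_erase hk)]
  rw [symbolOp, Matrix.of_apply, ← Finset.mul_prod_erase _ _ (Finset.mem_univ i), this, mul_comm,
    siteSymbol, Function.update_self, mul_add, map_add, mul_comm _ (MvPolynomial.C _),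
    ← MvPolynomial.smul_eq_C_mul, map_smul, smul_eq_mul, map_one, one_mul]

/-- The contribution of the pair of sites `i, j` to the commutators below. -/
def pairTerm (y : Fin n → ℂ) (L : MvPolynomial (Fin N × Fin N) ℂ →ₗ[ℂ] ℂ)
    (s t : Fin n → Fin N) (i j : Fin n) : ℂ :=
  L (restSymbol y s t i j * ((if s j = t i then 1 else 0) * MvPolynomial.X (t j, s i)
    - (if t j = s i then 1 else 0) * MvPolynomial.X (t i, s j)))

/-- Invariance is used with `q` the product of all factors except that of site `i`. The terms with
`y i` cancel, and a derivative of `q` hits the factor of some other site `j`, which produces the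
pair term. -/
theorem commutator_siteMat (y : Fin n → ℂ) (L : MvPolynomial (Fin N × Fin N) ℂ →ₗ[ℂ] ℂ)
    (h : Matrix (Fin N) (Fin N) ℂ)
    (hL : ∀ (q : MvPolynomial (Fin N × Fin N) ℂ) (a b : Fin N),
      ∑ c, (h a c * L (q * MvPolynomial.X (b, c))
        + L (MvPolynomial.pderiv (a, c) q * MvPolynomial.X (b, c)))
      = ∑ c, (h c b * L (q * MvPolynomial.X (c, a))
        + L (MvPolynomial.pderiv (c, b) q * MvPolynomial.X (c, a))))
    (i : Fin n) (s t : Fin n → Fin N) :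
    (siteMat i h * symbolOp y L) s t - (symbolOp y L * siteMat i h) s t
      = ∑ j ∈ Finset.univ.erase i, pairTerm y L s t i j := by
  rw [siteMat_mul_apply, mul_siteMat_apply]
  simp only [symbolOp_update_left, symbolOp_update_right]
  have key := hL (∏ k ∈ Finset.univ.erase i, siteSymbol y (fun _ => 1) s t k) (s i) (t i)
  have e1 : ∑ c, L (MvPolynomial.pderiv (s i, c)
      (∏ k ∈ Finset.univ.erase i, siteSymbol y (fun _ => 1) s t k) * MvPolynomial.X (t i, c))
      = ∑ j ∈ Finset.univ.erase i, L (restSymbol y s t i j *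
        ((if t j = s i then 1 else 0) * MvPolynomial.X (t i, s j))) := by
    simp only [pderiv_prod_siteSymbol, Finset.sum_mul, map_sum]
    rw [Finset.sum_comm]
    refine Finset.sum_congr rfl fun j _ => ?_
    rw [Finset.sum_eq_single (s j)]
    · simp [restSymbol]
    · intro c _ hc
      simp [hc.symm]
    · simp
  have e2 : ∑ c, L (MvPolynomial.pderiv (c, t i)
      (∏ k ∈ Finset.univ.erase i, siteSymbol y (fun _ => 1) s t k) * MvPolynomial.X (c, s i))
      = ∑ j ∈ Finset.univ.erase i, L (restSymbol y s t i j *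
        ((if s j = t i then 1 else 0) * MvPolynomial.X (t j, s i))) := by
    simp only [pderiv_prod_siteSymbol, Finset.sum_mul, map_sum]
    rw [Finset.sum_comm]
    refine Finset.sum_congr rfl fun j _ => ?_
    rw [Finset.sum_eq_single (t j)]
    · simp [restSymbol]
    · intro c _ hc
      simp [hc.symm]
    · simp
  rw [Finset.sum_add_distrib, Finset.sum_add_distrib, e1, e2] at key
  simp only [pairTerm, mul_sub, map_sub, Finset.sum_sub_distrib, mul_add, add_mul,
    Finset.sum_add_distrib]
  have e3 : ∑ c, h (s i) c * ((if c = t i then y i else 0)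
      * L (∏ k ∈ Finset.univ.erase i, siteSymbol y (fun _ => 1) s t k))
      = ∑ c, (if s i = c then y i else 0)
      * L (∏ k ∈ Finset.univ.erase i, siteSymbol y (fun _ => 1) s t k) * h c (t i) := by
    simp
    ring
  rw [e3]
  simp only [mul_comm _ (h _ (t i))] at key ⊢
  linear_combination key

/-- The swap affects only the factors `i` and `j`. In the difference of the two products the terms
with $y_iy_j$ and those quadratic in the variables cancel; the mixed ones remain. -/
theorem commutator_swapMat (y : Fin n → ℂ) (L : MvPolynomial (Fin N × Fin N) ℂ →ₗ[ℂ] ℂ)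
    {i j : Fin n} (hij : j ≠ i) (s t : Fin n → Fin N) :
    ((swapMat i j : Op N n) * symbolOp y L) s t - (symbolOp y L * (swapMat i j : Op N n)) s t
      = (y i - y j) * pairTerm y L s t i j := by
  have hj : j ∈ Finset.univ.erase i := by simp [hij]
  have expand : ∀ u v : Fin n → Fin N, ∏ k, siteSymbol y (fun _ => 1) u v k
      = siteSymbol y (fun _ => 1) u v i * (siteSymbol y (fun _ => 1) u v j
        * restSymbol y u v i j) := fun u v => by
    rw [← Finset.mul_prod_erase _ _ (Finset.mem_univ i), ← Finset.mul_prod_erase _ _ hj]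
    rfl
  have hr : ∀ k ∈ (Finset.univ.erase i).erase j, Equiv.swap i j k = k := fun k hk =>
    Equiv.swap_apply_of_ne_of_ne (Finset.ne_of_mem_erase (Finset.mem_of_mem_erase hk))
      (Finset.ne_of_mem_erase hk)
  have r1 : restSymbol y (s ∘ Equiv.swap i j) t i j = restSymbol y s t i j :=
    Finset.prod_congr rfl fun k hk => by simp [siteSymbol, hr k hk]
  have r2 : restSymbol y s (t ∘ Equiv.swap i j) i j = restSymbol y s t i j :=
    Finset.prod_congr rfl fun k hk => by simp [siteSymbol, hr k hk]
  rw [swapMat_mul_apply, mul_swapMat_apply, symbolOp, Matrix.of_apply, Matrix.of_apply, ← map_sub,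
    pairTerm, ← smul_eq_mul, ← map_smul, expand, expand, r1, r2, MvPolynomial.smul_eq_C_mul]
  congr 1
  simp only [siteSymbol, Function.comp_apply, Equiv.swap_apply_left, Equiv.swap_apply_right,
    eq_comm (a := t j) (b := s i), map_one, one_mul, map_sub]
  by_cases h1 : s j = t i <;> by_cases h2 : s i = t j <;> simp [h1, h2] <;> ring

/-- The Gaudin Hamiltonian at the site `i`. -/
def hamiltonian (xs : Fin n → ℂ) (h : Matrix (Fin N) (Fin N) ℂ) (i : Fin n) : Op N n :=
  siteMat i h + ∑ j ∈ Finset.univ.erase i, (xs i - xs j)⁻¹ • swapMat i j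

theorem commute_hamiltonian_symbolOp (xs y : Fin n → ℂ) (hxs : Function.Injective xs)
    (hy : ∀ i j, y i - y j = xs j - xs i) (L : MvPolynomial (Fin N × Fin N) ℂ →ₗ[ℂ] ℂ)
    (h : Matrix (Fin N) (Fin N) ℂ)
    (hL : ∀ (q : MvPolynomial (Fin N × Fin N) ℂ) (a b : Fin N),
      ∑ c, (h a c * L (q * MvPolynomial.X (b, c))
        + L (MvPolynomial.pderiv (a, c) q * MvPolynomial.X (b, c)))
      = ∑ c, (h c b * L (q * MvPolynomial.X (c, a))
        + L (MvPolynomial.pderiv (c, b) q * MvPolynomial.X (c, a))))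
    (i : Fin n) : Commute (hamiltonian xs h i) (symbolOp y L) := by
  rw [commute_iff_eq, ← sub_eq_zero]
  ext s t
  rw [hamiltonian, add_mul, mul_add, Finset.sum_mul, Finset.mul_sum, add_sub_add_comm,
    ← Finset.sum_sub_distrib, Matrix.add_apply, Matrix.sub_apply, commutator_siteMat y L h hL,
    Matrix.sum_apply, ← Finset.sum_add_distrib]
  refine Finset.sum_eq_zero fun j hj => ?_
  have hji : j ≠ i := Finset.ne_of_mem_erase hj
  rw [Matrix.smul_mul, Matrix.mul_smul, ← smul_sub, Matrix.smul_apply, Matrix.sub_apply,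
    commutator_swapMat y L hji, hy, smul_eq_mul]
  have : xs i - xs j ≠ 0 := sub_ne_zero.2 fun e => hji (hxs e).symm
  field_simp
  ring

end Hamiltonians

end

end Gaudin

namespace Gaudin

noncomputable section

/-! ### Cyclic vectors and commutative centralizers -/

section CyclicVector

variable {ι : Type*} [Fintype ι] [DecidableEq ι]

/-- The matrix whose columns are the images of the all-ones vector under powers of `H`. -/
def krylov {R : Type*} [CommRing R] (e : ι → ℕ) (H : Matrix ι ι R) : Matrix ι ι R :=
  Matrix.of fun s u => ∑ v, (H ^ e u) s v

theorem map_krylov {R S : Type*} [CommRing R] [CommRing S] (φ : R →+* S) (e : ι → ℕ)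
    (H : Matrix ι ι R) : φ.mapMatrix (krylov e H) = krylov e (φ.mapMatrix H) := by
  ext s u
  simp only [krylov, RingHom.mapMatrix_apply, Matrix.map_apply, Matrix.of_apply, map_sum]
  rw [← RingHom.mapMatrix_apply, ← map_pow]
  rfl

/-- Invertibility makes the all-ones vector cyclic for `H`, so a matrix commuting with `H` is
determined by its value there and is therefore a polynomial in `H`. -/
theorem commute_of_krylov (e : ι → ℕ) (H : Matrix ι ι ℂ) (hH : (krylov e H).det ≠ 0)
    {A B : Matrix ι ι ℂ} (hA : Commute H A) (hB : Commute H B) : Commute A B := by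
  have hK : IsUnit (krylov e H).det := isUnit_iff_ne_zero.2 hH
  let v : ι → ℂ := fun _ => 1
  let a : ι → ℂ := (krylov e H)⁻¹ *ᵥ (A *ᵥ v)
  have ha : krylov e H *ᵥ a = A *ᵥ v := by
    rw [Matrix.mulVec_mulVec, Matrix.mul_nonsing_inv _ hK, Matrix.one_mulVec]
  let q : Matrix ι ι ℂ := ∑ u, a u • H ^ e u
  have hcol : ∀ u, (fun s => krylov e H s u) = H ^ e u *ᵥ v := fun u => by
    ext s
    simp [krylov, v, Matrix.mulVec, dotProduct]
  have hq : q *ᵥ v = A *ᵥ v := by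
    rw [← ha]
    ext s
    simp only [q, Matrix.sum_mulVec, Finset.sum_apply, Matrix.smul_mulVec, Pi.smul_apply, ← hcol,
      smul_eq_mul]
    rw [Matrix.mulVec, dotProduct]
    exact Finset.sum_congr rfl fun u _ => mul_comm _ _
  have hcomm : ∀ B : Matrix ι ι ℂ, Commute H B → Commute B q := fun B hB =>
    Commute.sum_right _ _ _ fun u _ => (hB.symm.pow_right _).smul_right _
  -- `A - q` kills the cyclic vector and commutes with `H`, hence kills every column.
  have hz : (A - q) * krylov e H = 0 := by
    ext s u
    have hc : Commute (A - q) (H ^ e u) :=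
      (hA.symm.sub_left (hcomm H (Commute.refl H)).symm).pow_right _
    have : ((A - q) * krylov e H) s u = ((A - q) *ᵥ fun s => krylov e H s u) s := rfl
    rw [this, hcol, Matrix.mulVec_mulVec, hc.eq, ← Matrix.mulVec_mulVec, Matrix.sub_mulVec, hq,
      sub_self, Matrix.mulVec_zero]
    rfl
  have hAq : A = q := by
    rw [← sub_eq_zero, ← Matrix.mul_one (A - q), ← Matrix.mul_nonsing_inv _ hK, ← mul_assoc, hz,
      zero_mul]
  rw [hAq]
  exact (hcomm B hB).symm

/-- Applied to the all-ones vector, the powers of a diagonal matrix give a Vandermonde matrix. -/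
theorem krylov_diagonal_det_ne_zero {d : ι → ℂ} (hd : Function.Injective d) :
    (krylov (fun u => (Fintype.equivFin ι u : ℕ)) (Matrix.diagonal d)).det ≠ 0 := by
  have : krylov (fun u => (Fintype.equivFin ι u : ℕ)) (Matrix.diagonal d)
      = (Matrix.vandermonde (d ∘ (Fintype.equivFin ι).symm)).submatrix
        (Fintype.equivFin ι) (Fintype.equivFin ι) := by
    ext s u
    simp [krylov, Matrix.diagonal_pow, Matrix.diagonal_apply, Matrix.vandermonde_apply]
  rw [this, Matrix.det_submatrix_equiv_self, Matrix.det_vandermonde_ne_zero_iff]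
  exact hd.comp (Equiv.injective _)

open Polynomial in
-- Genericity is tested at $\varepsilon=\infty$: with $t=1/\varepsilon$ the Krylov determinant of
-- $D+tM$ is a polynomial in $t$, nonzero at $t=0$, so only finitely many $\varepsilon$ are bad.
theorem eventually_commute_of_commute_add_smul_diagonal (M : Matrix ι ι ℂ) {d : ι → ℂ}
    (hd : Function.Injective d) :
    ∀ᶠ ε : ℂ in nhdsWithin 0 {0}ᶜ, ∀ A B : Matrix ι ι ℂ,
      Commute (M + ε • Matrix.diagonal d) A → Commute (M + ε • Matrix.diagonal d) B →
      Commute A B := by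
  let e : ι → ℕ := fun u => (Fintype.equivFin ι u : ℕ)
  let Z : Matrix ι ι ℂ[X] := (Matrix.diagonal d).map C + (X : ℂ[X]) • M.map C
  let p : ℂ[X] := (krylov e Z).det
  have hp : ∀ t : ℂ, p.eval t = (krylov e (Matrix.diagonal d + t • M)).det := by
    intro t
    have hZ : (Polynomial.evalRingHom t).mapMatrix Z = Matrix.diagonal d + t • M := by
      ext s u
      by_cases hsu : s = u <;> simp [Z, hsu, mul_comm t]
    rw [← hZ, ← map_krylov, ← RingHom.map_det]
    rfl
  have hp0 : p ≠ 0 := by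
    intro h
    have := hp 0
    rw [h, zero_smul, add_zero, Polynomial.eval_zero] at this
    exact krylov_diagonal_det_ne_zero hd this.symm
  have hfin : {ε : ℂ | p.eval ε⁻¹ = 0}.Finite := by
    refine Set.Finite.preimage (inv_injective.injOn) (s := {t : ℂ | p.eval t = 0}) ?_
    refine (p.roots.toFinset.finite_toSet).subset fun t ht => ?_
    simpa [hp0] using ht
  have h1 : ∀ᶠ ε : ℂ in nhdsWithin 0 {0}ᶜ, p.eval ε⁻¹ ≠ 0 :=
    nhdsNE_le_cofinite 0 hfin.compl_mem_cofinite
  filter_upwards [h1, self_mem_nhdsWithin] with ε hε hε0 A B hA hB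
  have hε0 : ε ≠ 0 := hε0
  have hH : Matrix.diagonal d + ε⁻¹ • M = ε⁻¹ • (M + ε • Matrix.diagonal d) := by
    rw [smul_add, smul_smul, inv_mul_cancel₀ hε0, one_smul, add_comm]
  rw [hp, hH] at hε
  exact commute_of_krylov e _ hε (hA.smul_left _) (hB.smul_left _)

end CyclicVector

/-! ### Commutation for invariant analytic functions -/

section Commutation

attribute [local instance] Matrix.linftyOpNormedRing Matrix.linftyOpNormedAlgebra
attribute [local instance] matrixTopology

variable {N n : ℕ}

theorem prodOp_eq_symbolOp {U : Set (Matrix (Fin N) (Fin N) ℂ)} (hU : IsOpen U) (y : Fin n → ℂ)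
    (f : Matrix (Fin N) (Fin N) ℂ → ℂ) (hf : AnalyticOnNhd ℂ f U)
    {h : Matrix (Fin N) (Fin N) ℂ} (hh : h ∈ U) :
    prodOp y (fun _ => 1) f h = symbolOp y (jetFunctional hU f hf h) := by
  ext s t
  rw [prodOp_apply hU y _ f hf hh]
  rfl

/-- A combination of the Hamiltonians whose spectrum is simple for generic `h`. -/
def totalHamiltonian (xs : Fin n → ℂ) (h : Matrix (Fin N) (Fin N) ℂ) : Op N n :=
  ∑ i : Fin n, ((N : ℂ) ^ (i : ℕ)) • hamiltonian xs h i

theorem totalHamiltonian_add_smul_diagonal (xs : Fin n → ℂ) (h : Matrix (Fin N) (Fin N) ℂ)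
    (ε : ℂ) (κ : Fin N → ℂ) :
    totalHamiltonian xs (h + ε • Matrix.diagonal κ)
      = totalHamiltonian xs h
        + ε • Matrix.diagonal fun s : Fin n → Fin N => ∑ i : Fin n, (N : ℂ) ^ (i : ℕ) * κ (s i) := by
  have hs : ∀ i : Fin n, (siteMat i (h + ε • Matrix.diagonal κ) : Op N n)
      = siteMat i h + ε • Matrix.diagonal fun s => κ (s i) := by
    intro i
    ext s t
    simp only [siteMat, Matrix.of_apply, Matrix.add_apply, Matrix.smul_apply,
      Matrix.diagonal_apply]
    have : s = t ↔ (∀ k, k ≠ i → s k = t k) ∧ s i = t i := by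
      constructor
      · rintro rfl
        simp
      · rintro ⟨h1, h2⟩
        funext k
        by_cases hk : k = i
        · rw [hk, h2]
        · exact h1 k hk
    rw [if_congr this rfl rfl]
    by_cases h1 : ∀ k, k ≠ i → s k = t k
    · simp only [if_pos h1, and_iff_right h1]
    · simp only [if_neg h1, if_neg fun h : (∀ k, k ≠ i → s k = t k) ∧ s i = t i => h1 h.1,
        smul_zero, add_zero]
  have hd : (Matrix.diagonal fun s : Fin n → Fin N => ∑ i : Fin n, (N : ℂ) ^ (i : ℕ) * κ (s i))
      = ∑ i : Fin n, (N : ℂ) ^ (i : ℕ) • (Matrix.diagonal fun s => κ (s i) : Op N n) := by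
    ext s t
    by_cases hst : s = t
    · subst hst
      simp [Matrix.sum_apply]
    · simp [Matrix.sum_apply, hst]
  rw [hd, Finset.smul_sum, totalHamiltonian, totalHamiltonian, ← Finset.sum_add_distrib]
  refine Finset.sum_congr rfl fun i _ => ?_
  rw [hamiltonian, hs, hamiltonian, smul_comm ε, ← smul_add, add_right_comm]

/-- The weights $N^i$ make the eigenvalue a base-$N$ expansion, from which the digits `s i` can be
read off. -/
theorem injective_digits (N n : ℕ) : Function.Injective fun s : Fin n → Fin N =>
    ∑ i : Fin n, (N : ℂ) ^ (i : ℕ) * ((s i : ℕ) : ℂ) := by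
  intro s t hst
  apply finFunctionFinEquiv.injective
  apply Fin.ext
  rw [finFunctionFinEquiv_apply, finFunctionFinEquiv_apply]
  have : ((∑ i : Fin n, N ^ (i : ℕ) * (s i : ℕ) : ℕ) : ℂ)
      = ((∑ i : Fin n, N ^ (i : ℕ) * (t i : ℕ) : ℕ) : ℂ) := by
    push_cast
    exact hst
  simpa only [mul_comm] using Nat.cast_injective this

theorem commute_totalHamiltonian_prodOp {xs y : Fin n → ℂ} (hxs : Function.Injective xs)
    (hy : ∀ i j, y i - y j = xs j - xs i) {f : Matrix (Fin N) (Fin N) ℂ → ℂ}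
    (hinv : ConjInvariant f) {h : Matrix (Fin N) (Fin N) ℂ} (hf : AnalyticAt ℂ f h) :
    Commute (totalHamiltonian xs h) (prodOp y (fun _ => 1) f h) := by
  rw [prodOp_eq_symbolOp (isOpen_analyticAt ℂ f) y f (fun _ hx => hx) hf]
  refine Commute.sum_left _ _ _ fun i _ => Commute.smul_left ?_ _
  exact commute_hamiltonian_symbolOp xs y hxs hy _ h
    (jetFunctional_invariance (isOpen_analyticAt ℂ f) f (fun _ hx => hx) hinv h) i

theorem continuousAt_prodOp_apply (y : Fin n → ℂ) {f : Matrix (Fin N) (Fin N) ℂ → ℂ}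
    {h : Matrix (Fin N) (Fin N) ℂ} (hf : AnalyticAt ℂ f h) (s t : Fin n → Fin N) :
    ContinuousAt (fun h => prodOp y (fun _ => 1) f h s t) h := by
  have hU := isOpen_analyticAt ℂ f
  let g := entryDiff hU (∏ i, siteSymbol y (fun _ => 1) s t i)
    (analyticFun.restrict hU f fun _ hx => hx)
  have hg : ContinuousAt (g : Matrix (Fin N) (Fin N) ℂ → ℂ) h := (g.2.1 h hf).continuousAt
  refine hg.congr (Filter.eventuallyEq_of_mem (hU.mem_nhds hf) fun x hx => ?_)
  exact (prodOp_apply hU y _ f (fun _ hx => hx) hx s t).symm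

/-- At fixed `h` the matrix elements are polynomials in the shifts `y`. -/
theorem continuous_prodOp_apply_param {y : ℂ → Fin n → ℂ} (hy : ∀ i, Continuous fun ε => y ε i)
    {f : Matrix (Fin N) (Fin N) ℂ → ℂ} {h : Matrix (Fin N) (Fin N) ℂ} (hf : AnalyticAt ℂ f h)
    (s t : Fin n → Fin N) : Continuous fun ε => prodOp (y ε) (fun _ => 1) f h s t := by
  have hU := isOpen_analyticAt ℂ f
  have hexp : ∀ ε, prodOp (y ε) (fun _ => 1) f h s t
      = ∑ S ∈ Finset.univ.powerset, (∏ i ∈ S, if s i = t i then y ε i else 0)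
        * jetFunctional hU f (fun _ hx => hx) h
          (∏ i ∈ Finset.univ \ S, MvPolynomial.X (t i, s i)) := by
    intro ε
    rw [prodOp_eq_symbolOp hU (y ε) f (fun _ hx => hx) hf, symbolOp, Matrix.of_apply]
    simp only [siteSymbol, map_one, one_mul]
    rw [Finset.prod_add, map_sum]
    refine Finset.sum_congr rfl fun S _ => ?_
    rw [← map_prod, ← MvPolynomial.smul_eq_C_mul, map_smul, smul_eq_mul]
  simp only [hexp]
  refine continuous_finsetSum _ fun S _ => Continuous.mul (continuous_finsetProd _ fun i _ => ?_)
    continuous_const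
  split_ifs
  · exact hy i
  · exact continuous_const

theorem commute_of_eventually_commute {ι : Type*} [Fintype ι] {A B : ℂ → Matrix ι ι ℂ}
    (hA : ∀ s t, ContinuousAt (fun ε => A ε s t) 0) (hB : ∀ s t, ContinuousAt (fun ε => B ε s t) 0)
    (h : ∀ᶠ ε : ℂ in nhdsWithin 0 {0}ᶜ, Commute (A ε) (B ε)) : Commute (A 0) (B 0) := by
  rw [commute_iff_eq]
  ext s t
  have hl : ContinuousAt (fun ε => (A ε * B ε) s t) 0 := by
    simp only [Matrix.mul_apply]
    exact tendsto_finsetSum _ fun u _ => (hA s u).mul (hB u t)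
  have hr : ContinuousAt (fun ε => (B ε * A ε) s t) 0 := by
    simp only [Matrix.mul_apply]
    exact tendsto_finsetSum _ fun u _ => (hB s u).mul (hA u t)
  refine tendsto_nhds_unique (l := nhdsWithin (0 : ℂ) {0}ᶜ) (hl.tendsto.mono_left nhdsWithin_le_nhds)
    ((hr.tendsto.mono_left nhdsWithin_le_nhds).congr' ?_)
  filter_upwards [h] with ε hε
  rw [hε.eq]

/-- The twist is moved along a diagonal direction. Operators and Hamiltonian are all taken at the
moved twist, where the Hamiltonian has a cyclic vector; continuity brings the result back to `h`. -/
theorem commute_prodOp_of_injective {xs : Fin n → ℂ} (hxs : Function.Injective xs) (x x' : ℂ)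
    {f g : Matrix (Fin N) (Fin N) ℂ → ℂ} (hf : ConjInvariant f) (hg : ConjInvariant g)
    {h : Matrix (Fin N) (Fin N) ℂ} (hfa : AnalyticAt ℂ f h) (hga : AnalyticAt ℂ g h) :
    Commute (prodOp (fun i => x - xs i) (fun _ => 1) f h)
      (prodOp (fun i => x' - xs i) (fun _ => 1) g h) := by
  let l : ℂ → Matrix (Fin N) (Fin N) ℂ := fun ε => h + ε • Matrix.diagonal fun a : Fin N => ((a : ℕ) : ℂ)
  have hl0 : l 0 = h := by simp [l]
  have hl : ContinuousAt l 0 := by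
    have : Continuous l := by fun_prop
    exact this.continuousAt
  have key : Commute (prodOp (fun i => x - xs i) (fun _ => 1) f (l 0))
      (prodOp (fun i => x' - xs i) (fun _ => 1) g (l 0)) := by
    refine commute_of_eventually_commute (A := fun ε => prodOp (fun i => x - xs i) _ f (l ε))
      (B := fun ε => prodOp (fun i => x' - xs i) _ g (l ε)) (fun s t => ?_) (fun s t => ?_) ?_
    · refine ContinuousAt.comp (f := l)
        (g := fun h => prodOp (fun i => x - xs i) (fun _ => 1) f h s t) ?_ hl
      rw [hl0]
      exact continuousAt_prodOp_apply _ hfa s t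
    · refine ContinuousAt.comp (f := l)
        (g := fun h => prodOp (fun i => x' - xs i) (fun _ => 1) g h s t) ?_ hl
      rw [hl0]
      exact continuousAt_prodOp_apply _ hga s t
    · have h1 := eventually_commute_of_commute_add_smul_diagonal (totalHamiltonian xs h)
        (injective_digits N n)
      have h2 : ∀ᶠ ε in nhds (0 : ℂ), AnalyticAt ℂ f (l ε) :=
        hl.eventually ((isOpen_analyticAt ℂ f).mem_nhds (by rw [hl0]; exact hfa))
      have h3 : ∀ᶠ ε in nhds (0 : ℂ), AnalyticAt ℂ g (l ε) :=
        hl.eventually ((isOpen_analyticAt ℂ g).mem_nhds (by rw [hl0]; exact hga))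
      filter_upwards [h1, nhdsWithin_le_nhds h2, nhdsWithin_le_nhds h3] with ε e1 e2 e3
      rw [← totalHamiltonian_add_smul_diagonal xs h ε fun a : Fin N => ((a : ℕ) : ℂ)] at e1
      exact e1 _ _ (commute_totalHamiltonian_prodOp hxs (fun i j => by ring) hf e2)
        (commute_totalHamiltonian_prodOp hxs (fun i j => by ring) hg e3)
  rwa [hl0] at key

theorem eventually_injective_add_mul (xs : Fin n → ℂ) :
    ∀ᶠ ε : ℂ in nhdsWithin 0 {0}ᶜ, Function.Injective fun i : Fin n => xs i + ε * ((i : ℕ) : ℂ) := by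
  have h : ∀ i j : Fin n, ∀ᶠ ε : ℂ in nhdsWithin 0 {0}ᶜ,
      xs i + ε * ((i : ℕ) : ℂ) = xs j + ε * ((j : ℕ) : ℂ) → i = j := by
    intro i j
    by_cases hij : i = j
    · exact Filter.Eventually.of_forall fun _ _ => hij
    · have hne : ((i : ℕ) : ℂ) - ((j : ℕ) : ℂ) ≠ 0 :=
        sub_ne_zero.2 fun e => hij (Fin.ext (Nat.cast_injective e))
      have hfin : {ε : ℂ | xs i + ε * ((i : ℕ) : ℂ) = xs j + ε * ((j : ℕ) : ℂ)}.Finite := by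
        refine Set.Subsingleton.finite fun ε hε δ hδ => mul_right_cancel₀ hne ?_
        have h1 : xs i + ε * ((i : ℕ) : ℂ) = xs j + ε * ((j : ℕ) : ℂ) := hε
        have h2 : xs i + δ * ((i : ℕ) : ℂ) = xs j + δ * ((j : ℕ) : ℂ) := hδ
        linear_combination h1 - h2
      filter_upwards [nhdsNE_le_cofinite 0 hfin.compl_mem_cofinite] with ε hε heq
      exact absurd heq hε
  filter_upwards [Filter.eventually_all.2 fun i => Filter.eventually_all.2 (h i)] with ε hε i j hij
  exact hε i j hij

theorem commute_prodOp (xs : Fin n → ℂ) (x x' : ℂ)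
    {f g : Matrix (Fin N) (Fin N) ℂ → ℂ} (hf : ConjInvariant f) (hg : ConjInvariant g)
    {h : Matrix (Fin N) (Fin N) ℂ} (hfa : AnalyticAt ℂ f h) (hga : AnalyticAt ℂ g h) :
    Commute (prodOp (fun i => x - xs i) (fun _ => 1) f h)
      (prodOp (fun i => x' - xs i) (fun _ => 1) g h) := by
  have key := commute_of_eventually_commute
    (A := fun ε => prodOp (fun i => x - (xs i + ε * ((i : ℕ) : ℂ))) (fun _ => 1) f h)
    (B := fun ε => prodOp (fun i => x' - (xs i + ε * ((i : ℕ) : ℂ))) (fun _ => 1) g h)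
    (fun s t => (continuous_prodOp_apply_param (fun i => by fun_prop) hfa s t).continuousAt)
    (fun s t => (continuous_prodOp_apply_param (fun i => by fun_prop) hga s t).continuousAt)
    ((eventually_injective_add_mul xs).mono fun ε hε =>
      commute_prodOp_of_injective hε x x' hf hg hfa hga)
  simpa using key

theorem gaudinOpRat_eq_smul (xs : Fin n → ℂ) (x : ℂ) (hx : ∀ i, x ≠ xs i)
    {f : Matrix (Fin N) (Fin N) ℂ → ℂ} {h : Matrix (Fin N) (Fin N) ℂ} (hf : AnalyticAt ℂ f h) :
    gaudinOpRat xs x f h = (∏ i, 1 / (x - xs i)) • (gaudinOp xs x f h : Op N n) := by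
  have hU := isOpen_analyticAt ℂ f
  ext s t
  rw [Matrix.smul_apply, gaudinOpRat, gaudinOp, prodOp_apply hU _ _ f (fun _ hx => hx) hf,
    prodOp_apply hU _ _ f (fun _ hx => hx) hf]
  have : ∏ i, siteSymbol (fun _ => 1) (fun i => 1 / (x - xs i)) s t i
      = (∏ i, 1 / (x - xs i)) • ∏ i, siteSymbol (fun i => x - xs i) (fun _ => 1) s t i := by
    rw [MvPolynomial.smul_eq_C_mul, map_prod, ← Finset.prod_mul_distrib]
    refine Finset.prod_congr rfl fun i _ => ?_
    have hne : x - xs i ≠ 0 := sub_ne_zero.2 (hx i)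
    rw [siteSymbol, siteSymbol, mul_add, ← mul_assoc, ← MvPolynomial.C_mul, ← MvPolynomial.C_mul,
      mul_one]
    split_ifs
    · rw [one_div_mul_cancel hne]
    · rw [mul_zero]
  rw [this, map_smul]
  rfl

theorem commute_gaudinOp (xs : Fin n → ℂ) (x x' : ℂ)
    {f g : Matrix (Fin N) (Fin N) ℂ → ℂ} (hf : ConjInvariant f) (hg : ConjInvariant g)
    {h : Matrix (Fin N) (Fin N) ℂ} (hfa : AnalyticAt ℂ f h) (hga : AnalyticAt ℂ g h) :
    Commute (gaudinOp xs x f h) (gaudinOp xs x' g h) ∧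
      ((∀ i, x ≠ xs i) → (∀ i, x' ≠ xs i) →
        Commute (gaudinOpRat xs x f h) (gaudinOpRat xs x' g h)) := by
  refine ⟨commute_prodOp xs x x' hf hg hfa hga, fun hx hx' => ?_⟩
  rw [gaudinOpRat_eq_smul xs x hx hfa, gaudinOpRat_eq_smul xs x' hx' hga]
  exact ((commute_prodOp xs x x' hf hg hfa hga).smul_left _).smul_right _

end Commutation

end

end Gaudin

/-! ### Analyticity of power series beyond the spectral radius -/

namespace Gaudin

noncomputable section

/-- The factor `z` keeps the case `q = 0` true without assuming that the unit has norm at most one.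
-/
theorem norm_pow_mul_le {A : Type*} [NormedRing A] (y z : A) (q : ℕ) : ‖y ^ q * z‖ ≤ ‖y‖ ^ q * ‖z‖ := by
  induction q with
  | zero => simp
  | succ q ih =>
    rw [pow_succ', mul_assoc, pow_succ', mul_assoc]
    exact (norm_mul_le _ _).trans (mul_le_mul_of_nonneg_left ih (norm_nonneg _))

section PowerSeries

variable {A : Type*} [NormedRing A] [NormedAlgebra ℂ A]

theorem mem_ball_radius_ofScalars (b : ℕ → ℂ) {R : ℝ} (hR : 0 ≤ R)
    (hb : Summable fun q => ‖b q‖ * R ^ q) {a : A} (ha : ‖a‖ < R) :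
    a ∈ Metric.eball (0 : A) (FormalMultilinearSeries.ofScalars A b).radius := by
  have h1 : ((R.toNNReal : NNReal) : ENNReal) ≤ (FormalMultilinearSeries.ofScalars A b).radius := by
    refine FormalMultilinearSeries.le_radius_of_summable _ ?_
    have hle : Summable fun q => (‖b q‖ * R ^ q) * max 1 ‖(1 : A)‖ := hb.mul_right _
    refine hle.of_nonneg_of_le (fun q => by positivity) fun q => ?_
    rw [Real.coe_toNNReal R hR, FormalMultilinearSeries.ofScalars_norm_eq_mul]
    have : ‖ContinuousMultilinearMap.mkPiAlgebraFin ℂ q A‖ ≤ max 1 ‖(1 : A)‖ := by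
      rcases Nat.eq_zero_or_pos q with rfl | hq
      · rw [ContinuousMultilinearMap.norm_mkPiAlgebraFin_zero]
        exact le_max_right _ _
      · exact (ContinuousMultilinearMap.norm_mkPiAlgebraFin_le_of_pos hq).trans (le_max_left _ _)
    calc ‖b q‖ * ‖ContinuousMultilinearMap.mkPiAlgebraFin ℂ q A‖ * R ^ q
        ≤ ‖b q‖ * max 1 ‖(1 : A)‖ * R ^ q := by gcongr
      _ = _ := by ring
  refine Metric.eball_subset_eball h1 ?_
  rw [Metric.mem_eball, edist_zero_right, ← ofReal_norm, ENNReal.ofReal]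
  exact ENNReal.coe_lt_coe.2 ((Real.toNNReal_lt_toNNReal_iff_of_nonneg (norm_nonneg a)).2 ha)

theorem summable_mul_functional_pow (τ : A →L[ℂ] ℂ) (c : ℕ → ℂ) {r : ℝ} (hr : 0 < r)
    (hc : Summable fun k => ‖c k‖ * r ^ k) {m : ℕ} (hm : 0 < m) {x : A} (hx : ‖x ^ m‖ < r ^ m) :
    Summable fun k => c k * τ (x ^ k) := by
  let K : ℝ := ∑ j ∈ Finset.range m, ‖x ^ j‖ / r ^ j
  have hK : ∀ k, ‖x ^ k‖ ≤ r ^ k * K := by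
    intro k
    have h1 : x ^ k = (x ^ m) ^ (k / m) * x ^ (k % m) := by
      rw [← pow_mul, ← pow_add, Nat.div_add_mod]
    have h2 : r ^ k = (r ^ m) ^ (k / m) * r ^ (k % m) := by
      rw [← pow_mul, ← pow_add, Nat.div_add_mod]
    have h3 : ‖x ^ (k % m)‖ / r ^ (k % m) ≤ K :=
      Finset.single_le_sum (f := fun j => ‖x ^ j‖ / r ^ j) (fun j _ => by positivity)
        (Finset.mem_range.2 (Nat.mod_lt k hm))
    have h4 : ‖x ^ (k % m)‖ ≤ r ^ (k % m) * K := by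
      rwa [div_le_iff₀' (by positivity)] at h3
    calc ‖x ^ k‖ ≤ ‖x ^ m‖ ^ (k / m) * ‖x ^ (k % m)‖ := by rw [h1]; exact norm_pow_mul_le _ _ _
      _ ≤ (r ^ m) ^ (k / m) * (r ^ (k % m) * K) := by gcongr
      _ = r ^ k * K := by rw [h2, mul_assoc]
  refine Summable.of_norm_bounded (hc.mul_right (‖τ‖ * K)) fun k => ?_
  calc ‖c k * τ (x ^ k)‖ ≤ ‖c k‖ * (‖τ‖ * ‖x ^ k‖) := by
        rw [norm_mul]
        exact mul_le_mul_of_nonneg_left (τ.le_opNorm _) (norm_nonneg _)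
    _ ≤ ‖c k‖ * (‖τ‖ * (r ^ k * K)) := by gcongr; exact hK k
    _ = _ := by ring

variable [CompleteSpace A]

theorem summable_smul_pow (b : ℕ → ℂ) {R : ℝ} (hR : 0 ≤ R)
    (hb : Summable fun q => ‖b q‖ * R ^ q) {a : A} (ha : ‖a‖ < R) :
    Summable fun q => b q • a ^ q := by
  have := FormalMultilinearSeries.summable _ (mem_ball_radius_ofScalars b hR hb ha)
  simpa only [FormalMultilinearSeries.ofScalars_apply_eq] using this

theorem analyticAt_tsum_smul_pow (b : ℕ → ℂ) {R : ℝ} (hR : 0 ≤ R)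
    (hb : Summable fun q => ‖b q‖ * R ^ q) {a : A} (ha : ‖a‖ < R) :
    AnalyticAt ℂ (fun x : A => ∑' q, b q • x ^ q) a := by
  have hmem := mem_ball_radius_ofScalars b hR hb ha
  have hpos : 0 < (FormalMultilinearSeries.ofScalars A b).radius :=
    lt_of_le_of_lt (zero_le) (Metric.mem_eball.1 hmem)
  have := ((FormalMultilinearSeries.ofScalars A b).hasFPowerSeriesOnBall hpos).analyticAt_of_mem
    hmem
  rwa [← FormalMultilinearSeries.ofScalarsSum_eq_tsum]

/-- The norm of `a` itself may exceed `r`; only a power is controlled. Splitting `k` by residues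
modulo `m` gives finitely many power series in `x ^ m`, each converging near `a ^ m`. -/
theorem analyticAt_tsum_functional_pow (τ : A →L[ℂ] ℂ) (c : ℕ → ℂ) {r : ℝ} (hr : 0 < r)
    (hc : Summable fun k => ‖c k‖ * r ^ k) {m : ℕ} (hm : 0 < m) {a : A} (ha : ‖a ^ m‖ < r ^ m) :
    AnalyticAt ℂ (fun x => ∑' k, c k * τ (x ^ k)) a := by
  have : NeZero m := ⟨hm.ne'⟩
  have hcj : ∀ j, Summable fun q => ‖c (j + m * q)‖ * (r ^ m) ^ q := by
    intro j
    have hinj : Function.Injective fun q => j + m * q := fun p q h =>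
      Nat.eq_of_mul_eq_mul_left hm (Nat.add_left_cancel h)
    have := (hc.comp_injective hinj).mul_right (r ^ j)⁻¹
    refine this.congr fun q => ?_
    simp only [Function.comp_apply, pow_add, pow_mul]
    field_simp
  have hana : AnalyticAt ℂ (fun x : A => ∑ j : ZMod m,
      τ (x ^ j.val * ∑' q, c (j.val + m * q) • (x ^ m) ^ q)) a := by
    refine Finset.analyticAt_fun_sum _ fun j _ => ?_
    refine (τ.analyticAt _).comp ((analyticAt_id.pow _).mul ?_)
    exact AnalyticAt.comp (g := fun y : A => ∑' q, c (j.val + m * q) • y ^ q)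
      (analyticAt_tsum_smul_pow _ (by positivity) (hcj j.val) ha) (analyticAt_id.pow m)
  refine hana.congr ?_
  have hnear : ∀ᶠ x in nhds a, ‖x ^ m‖ < r ^ m :=
    ((continuous_pow m).norm.continuousAt.eventually_lt continuousAt_const ha)
  filter_upwards [hnear] with x hx
  rw [Nat.sumByResidueClasses (summable_mul_functional_pow τ c hr hc hm hx) m]
  refine Finset.sum_congr rfl fun j _ => ?_
  have hs := summable_smul_pow _ (by positivity) (hcj j.val) hx
  rw [← hs.tsum_mul_left, τ.map_tsum (hs.mul_left _)]
  refine tsum_congr fun q => ?_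
  rw [mul_smul_comm, map_smul, smul_eq_mul, pow_add, pow_mul]

/-- Gelfand's formula for the spectral radius. -/
theorem exists_norm_pow_lt (a : A) {r : ℝ} (hr : 0 < r) [Nontrivial A]
    (ha : ∀ κ ∈ spectrum ℂ a, ‖κ‖ < r) : ∃ m : ℕ, 0 < m ∧ ‖a ^ m‖ < r ^ m := by
  have h1 : spectralRadius ℂ a < (r.toNNReal : NNReal) := by
    refine spectrum.spectralRadius_lt_of_forall_lt a fun κ hκ => ?_
    rw [← NNReal.coe_lt_coe, Real.coe_toNNReal r hr.le]
    exact ha κ hκ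
  have h2 := (spectrum.pow_nnnorm_pow_one_div_tendsto_nhds_spectralRadius a).eventually_lt_const h1
  obtain ⟨m, hm, hm0⟩ := (h2.and (Filter.eventually_gt_atTop 0)).exists
  refine ⟨m, hm0, ?_⟩
  have hm' : (m : ℝ) ≠ 0 := Nat.cast_ne_zero.2 hm0.ne'
  have h3 := ENNReal.rpow_lt_rpow hm (show (0 : ℝ) < m from Nat.cast_pos.2 hm0)
  rw [← ENNReal.rpow_mul, one_div_mul_cancel hm', ENNReal.rpow_one, ENNReal.rpow_natCast,
    ← ENNReal.coe_pow, ENNReal.coe_lt_coe, ← NNReal.coe_lt_coe, NNReal.coe_pow,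
    Real.coe_toNNReal r hr.le] at h3
  exact h3

end PowerSeries

end

end Gaudin

namespace Gaudin

noncomputable section

/-! ### Invariance and analyticity of the four families -/

section ClassFunctions

attribute [local instance] Matrix.linftyOpNormedRing Matrix.linftyOpNormedAlgebra
attribute [local instance] matrixTopology

variable {N : ℕ}

theorem analyticAt_eval_entries (q : MvPolynomial (Fin N × Fin N) ℂ)
    (h : Matrix (Fin N) (Fin N) ℂ) :
    AnalyticAt ℂ (fun h : Matrix (Fin N) (Fin N) ℂ => MvPolynomial.eval (fun p => h p.1 p.2) q) h := by
  have := AnalyticAt.aeval_mvPolynomial (𝕜 := ℂ) (z := h)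
    (f := fun (h : Matrix (Fin N) (Fin N) ℂ) (p : Fin N × Fin N) => h p.1 p.2)
    (fun p => (entryFunctional p.1 p.2).analyticAt h) q
  simp only [MvPolynomial.aeval_eq_eval] at this
  exact this

theorem analyticAt_det {E ι : Type*} [NormedAddCommGroup E] [NormedSpace ℂ E] [Fintype ι]
    [DecidableEq ι] {F : E → Matrix ι ι ℂ} {x : E}
    (hF : ∀ i j, AnalyticAt ℂ (fun y => F y i j) x) : AnalyticAt ℂ (fun y => (F y).det) x := by
  simp only [Matrix.det_apply']
  exact Finset.analyticAt_fun_sum _ fun σ _ =>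
    analyticAt_const.mul (Finset.analyticAt_fun_prod _ fun i _ => hF _ _)

theorem analyticAt_det_one_sub_smul (z : ℂ) (h : Matrix (Fin N) (Fin N) ℂ) :
    AnalyticAt ℂ (fun h : Matrix (Fin N) (Fin N) ℂ => (1 - z • h).det) h :=
  analyticAt_det fun i j =>
    analyticAt_const.sub (analyticAt_const.mul ((entryFunctional i j).analyticAt h))

theorem conjInvariant_w_div_w (z ζ : ℂ) :
    ConjInvariant fun h : Matrix (Fin N) (Fin N) ℂ => w z h / w ζ h := by
  have key : ∀ (z : ℂ) (A B : Matrix (Fin N) (Fin N) ℂ),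
      (1 - z • (A * B)).det = (1 - z • (B * A)).det := fun z A B => by
    rw [← Matrix.smul_mul, Matrix.det_one_sub_mul_comm, Matrix.mul_smul]
  intro A B _
  simp only [w, key _ A B]

theorem analyticAt_w_div_w {z : ℂ} (ζ : ℂ) {h : Matrix (Fin N) (Fin N) ℂ}
    (hz : (1 - z • h).det ≠ 0) :
    AnalyticAt ℂ (fun h : Matrix (Fin N) (Fin N) ℂ => w z h / w ζ h) h := by
  simp only [w, div_inv_eq_mul]
  exact ((analyticAt_det_one_sub_smul z h).inv hz).mul (analyticAt_det_one_sub_smul ζ h)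

theorem analyticAt_character (ρ : PolynomialRep N) (h : Matrix (Fin N) (Fin N) ℂ) :
    AnalyticAt ℂ ρ.character h :=
  Finset.analyticAt_fun_sum _ fun i _ => analyticAt_eval_entries (ρ.entry i i) h

theorem character_coe (ρ : PolynomialRep N) (g : GL (Fin N) ℂ) :
    ρ.character (g : Matrix (Fin N) (Fin N) ℂ) = (ρ.toHom g).trace :=
  Finset.sum_congr rfl fun i _ => ρ.eval_entry g i i

/-- A character is a trace only on invertible matrices. For singular `B`, the matrix $B+\varepsilon$
is invertible for small $\varepsilon\ne0$, and continuity gives the limit. -/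
theorem conjInvariant_of_isUnit {f : Matrix (Fin N) (Fin N) ℂ → ℂ} (hf : Continuous f)
    (hinv : ∀ A B : Matrix (Fin N) (Fin N) ℂ, IsUnit A → IsUnit B → f (A * B) = f (B * A)) :
    ConjInvariant f := by
  intro A B hA
  have hu : ∀ᶠ ε : ℂ in nhdsWithin 0 {0}ᶜ, IsUnit (ε • (1 : Matrix (Fin N) (Fin N) ℂ) - -B) := by
    filter_upwards [nhdsNE_le_cofinite 0 (Matrix.finite_spectrum (-B)).compl_mem_cofinite]
      with ε hε
    have := spectrum.notMem_iff.1 hε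
    rwa [Algebra.algebraMap_eq_smul_one] at this
  have h1 : Continuous fun ε : ℂ => f (A * (ε • (1 : Matrix (Fin N) (Fin N) ℂ) - -B)) := by
    fun_prop
  have h2 : Continuous fun ε : ℂ => f ((ε • (1 : Matrix (Fin N) (Fin N) ℂ) - -B) * A) := by
    fun_prop
  have := tendsto_nhds_unique (l := nhdsWithin (0 : ℂ) {0}ᶜ)
    ((h1.tendsto 0).mono_left nhdsWithin_le_nhds)
    (((h2.tendsto 0).mono_left nhdsWithin_le_nhds).congr'
      (hu.mono fun ε hε => (hinv A _ hA hε).symm))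
  simpa using this

theorem conjInvariant_character (ρ : PolynomialRep N) : ConjInvariant ρ.character := by
  refine conjInvariant_of_isUnit (continuous_iff_continuousAt.2 fun h =>
    (analyticAt_character ρ h).continuousAt) ?_
  rintro _ _ ⟨A, rfl⟩ ⟨B, rfl⟩
  rw [← Units.val_mul, ← Units.val_mul, character_coe, character_coe, map_mul, map_mul,
    Matrix.trace_mul_comm]

theorem classFunctions_invariant_analytic {f : Matrix (Fin N) (Fin N) ℂ → ℂ}
    (hf : f ∈ classFunctions N) : ConjInvariant f ∧ ∀ h, AnalyticAt ℂ f h := by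
  induction hf using Submodule.span_induction with
  | mem _ hx =>
    obtain ⟨ρ, rfl⟩ := hx
    exact ⟨conjInvariant_character ρ, analyticAt_character ρ⟩
  | zero => exact ⟨fun _ _ _ => rfl, fun _ => analyticAt_const⟩
  | add f g _ _ hf hg =>
    exact ⟨fun A B hA => congrArg₂ (· + ·) (hf.1 A B hA) (hg.1 A B hA), fun h => (hf.2 h).add (hg.2 h)⟩
  | smul c f _ hf =>
    exact ⟨fun A B hA => congrArg (c * ·) (hf.1 A B hA), fun h => analyticAt_const.smul (hf.2 h)⟩

theorem charpolyRev_mul_comm (A B : Matrix (Fin N) (Fin N) ℂ) :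
    (A * B).charpolyRev = (B * A).charpolyRev := by
  rw [← Matrix.reverse_charpoly, ← Matrix.reverse_charpoly, Matrix.charpoly_mul_comm]

/-- The coefficients of the universal characteristic polynomial are polynomials in the matrix
entries. -/
theorem analyticAt_coeff_charpolyRev (k : ℕ) (h : Matrix (Fin N) (Fin N) ℂ) :
    AnalyticAt ℂ (fun h : Matrix (Fin N) (Fin N) ℂ => h.charpolyRev.coeff k) h := by
  have : ∀ h : Matrix (Fin N) (Fin N) ℂ, h.charpolyRev.coeff k
      = MvPolynomial.eval (fun p => h p.1 p.2)
        ((Matrix.charpoly.univ ℂ (Fin N)).coeff (Polynomial.revAt N k)) := by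
    intro h
    have h1 := Matrix.charpoly.univ_coeff_eval₂Hom (Fin N) (RingHom.id ℂ)
      (fun p => h p.1 p.2) (Polynomial.revAt N k)
    rw [← Matrix.reverse_charpoly, Polynomial.coeff_reverse, Matrix.charpoly_natDegree_eq_dim,
      Fintype.card_fin]
    exact h1.symm
  simp only [this]
  exact analyticAt_eval_entries _ h

/-- The constant coefficient is always $1$, so the recursion for the inverse series involves no
division. -/
theorem analyticAt_coeff_inv_charpolyRev (k : ℕ) (h : Matrix (Fin N) (Fin N) ℂ) :
    AnalyticAt ℂ (fun h : Matrix (Fin N) (Fin N) ℂ =>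
      PowerSeries.coeff k ((h.charpolyRev : PowerSeries ℂ)⁻¹)) h := by
  have h0 : ∀ h : Matrix (Fin N) (Fin N) ℂ,
      PowerSeries.constantCoeff (h.charpolyRev : PowerSeries ℂ) = 1 := fun h => by
    rw [← PowerSeries.coeff_zero_eq_constantCoeff_apply, Polynomial.coeff_coe,
      Polynomial.coeff_zero_eq_eval_zero, Matrix.eval_charpolyRev]
  induction k using Nat.strong_induction_on with
  | _ k ih =>
    simp only [PowerSeries.coeff_inv k, h0, Polynomial.coeff_coe]
    by_cases hk : k = 0
    · simp only [if_pos hk]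
      exact analyticAt_const
    · simp only [if_neg hk]
      refine analyticAt_const.mul (Finset.analyticAt_fun_sum _ fun p _ => ?_)
      by_cases hp : p.2 < k
      · simp only [if_pos hp]
        exact (analyticAt_coeff_charpolyRev p.1 h).mul (ih p.2 hp)
      · simp only [if_neg hp]
        exact analyticAt_const

theorem conjInvariant_schurCharacter (lam : YoungDiagram) :
    ConjInvariant (schurCharacter (N := N) lam) := by
  intro A B _
  simp only [schurCharacter, completeSymm, charpolyRev_mul_comm A B]

theorem analyticAt_schurCharacter (lam : YoungDiagram) (h : Matrix (Fin N) (Fin N) ℂ) :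
    AnalyticAt ℂ (schurCharacter lam) h := by
  refine analyticAt_det fun i j => ?_
  simp only [Matrix.of_apply, completeSymm]
  split_ifs
  · exact analyticAt_const
  · exact analyticAt_coeff_inv_charpolyRev _ h

theorem trace_mul_pow_comm (A B : Matrix (Fin N) (Fin N) ℂ) (k : ℕ) :
    ((A * B) ^ k).trace = ((B * A) ^ k).trace := by
  cases k with
  | zero => rfl
  | succ k =>
    have : (A * B) ^ (k + 1) = A * ((B * A) ^ k * B) := by
      rw [pow_succ', mul_assoc, ← mul_assoc, ← mul_assoc, mul_assoc A B, ← mul_assoc]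
      induction k with
      | zero => simp
      | succ k ih => rw [pow_succ, ← mul_assoc, ih, pow_succ]; simp only [mul_assoc]
    rw [this, Matrix.trace_mul_comm, mul_assoc, ← pow_succ]

theorem conjInvariant_masterFunction (t : ℕ+ → ℂ) :
    ConjInvariant (masterFunction (N := N) t) := by
  intro A B _
  simp only [masterFunction, trace_mul_pow_comm A B]

theorem analyticAt_masterFunction [NeZero N] {t : ℕ+ → ℂ} {r : ℝ} {h : Matrix (Fin N) (Fin N) ℂ}
    (hr : ∀ κ ∈ spectrum ℂ h, ‖κ‖ < r) (ht : Summable fun k : ℕ+ => ‖t k‖ * r ^ (k : ℕ)) :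
    AnalyticAt ℂ (masterFunction t) h := by
  have : CompleteSpace (Matrix (Fin N) (Fin N) ℂ) := FiniteDimensional.complete ℂ _
  obtain ⟨κ, hκ⟩ := spectrum.nonempty h
  -- Positivity of `r` comes from the existence of an eigenvalue, hence the need for `N ≠ 0`.
  have hr0 : 0 < r := (norm_nonneg κ).trans_lt (hr κ hκ)
  obtain ⟨m, hm, hlt⟩ := exists_norm_pow_lt h hr0 hr
  let c : ℕ → ℂ := fun k => if hk : 0 < k then t ⟨k, hk⟩ else 0
  have hc : ∀ k : ℕ+, c k = t k := fun k => dif_pos k.pos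
  have hc0 : ∀ k : ℕ, k ∉ Set.range ((↑) : ℕ+ → ℕ) → c k = 0 := fun k hk =>
    dif_neg fun h => hk ⟨⟨k, h⟩, rfl⟩
  have hsum : Summable fun k => ‖c k‖ * r ^ k := by
    refine (PNat.coe_injective.summable_iff fun k hk => ?_).1 ?_
    · rw [hc0 k hk, norm_zero, zero_mul]
    · refine ht.congr fun k => ?_
      rw [Function.comp_apply, hc]
  let τ : Matrix (Fin N) (Fin N) ℂ →L[ℂ] ℂ :=
    LinearMap.toContinuousLinearMap (Matrix.traceLinearMap (Fin N) ℂ ℂ)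
  have key := (analyticAt_tsum_functional_pow τ c hr0 hsum hm hlt).cexp
  refine key.congr (Filter.Eventually.of_forall fun x => congrArg Complex.exp ?_)
  change ∑' k, c k * τ (x ^ k) = _
  rw [← PNat.coe_injective.tsum_eq]
  · refine tsum_congr fun k => ?_
    rw [hc]
    rfl
  · intro k hk
    by_contra hk'
    exact hk (show c k * τ (x ^ k) = 0 by rw [hc0 k hk', zero_mul])

end ClassFunctions

end

end Gaudin

namespace Gaudin

theorem commute_of_subsingleton {ι : Type*} [Fintype ι] [Subsingleton ι] (A B : Matrix ι ι ℂ) :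
    Commute A B := by
  rw [commute_iff_eq]
  ext s t
  obtain rfl := Subsingleton.elim s t
  rw [Matrix.mul_apply, Matrix.mul_apply, Fintype.sum_subsingleton _ s,
    Fintype.sum_subsingleton _ s, mul_comm]

end Gaudin

theorem mainTheorem8 (N n : ℕ) (xs : Fin n → ℂ) (h : Matrix (Fin N) (Fin N) ℂ) :
    -- the operators built from the generating function of the hook characters commute
    (∀ (y : Fin n → ℂ) (z₁ ζ₁ z₂ ζ₂ : ℂ), (1 - z₁ • h).det ≠ 0 → (1 - z₂ • h).det ≠ 0 →
      Commute
        (Gaudin.prodOp y (fun _ => 1) (fun h' => Gaudin.w z₁ h' / Gaudin.w ζ₁ h') h)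
        (Gaudin.prodOp y (fun _ => 1) (fun h' => Gaudin.w z₂ h' / Gaudin.w ζ₂ h') h)) ∧
    -- arbitrary linear combinations of characters, arbitrary spectral parameters
    (∀ f₁ ∈ Gaudin.classFunctions N, ∀ f₂ ∈ Gaudin.classFunctions N, ∀ x x' : ℂ,
      Commute (Gaudin.gaudinOp xs x f₁ h) (Gaudin.gaudinOp xs x' f₂ h) ∧
      ((∀ i, x ≠ xs i) → (∀ i, x' ≠ xs i) →
        Commute (Gaudin.gaudinOpRat xs x f₁ h) (Gaudin.gaudinOpRat xs x' f₂ h))) ∧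
    -- the transfer matrices of two Young diagrams
    (∀ (lam mu : YoungDiagram) (x x' : ℂ),
      Commute (Gaudin.gaudinOp xs x (Gaudin.schurCharacter lam) h)
        (Gaudin.gaudinOp xs x' (Gaudin.schurCharacter mu) h) ∧
      ((∀ i, x ≠ xs i) → (∀ i, x' ≠ xs i) →
        Commute (Gaudin.gaudinOpRat xs x (Gaudin.schurCharacter lam) h)
          (Gaudin.gaudinOpRat xs x' (Gaudin.schurCharacter mu) h))) ∧
    -- the master operators, for times whose series converges beyond the spectral radius of `h`
    (∀ (t t' : ℕ+ → ℂ) (r : ℝ), (∀ κ ∈ spectrum ℂ h, ‖κ‖ < r) →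
      Summable (fun k : ℕ+ => ‖t k‖ * r ^ (k : ℕ)) →
      Summable (fun k : ℕ+ => ‖t' k‖ * r ^ (k : ℕ)) →
      ∀ x x' : ℂ, Commute (Gaudin.masterT xs x t h) (Gaudin.masterT xs x' t' h)) := by
  refine ⟨fun y z₁ ζ₁ z₂ ζ₂ h₁ h₂ => ?_, fun f₁ hf₁ f₂ hf₂ x x' => ?_, fun lam mu x x' => ?_,
    fun t t' r hr ht ht' x x' => ?_⟩
  -- Arbitrary shifts `y` correspond to the points $x_i=-y_i$ with both spectral parameters zero.
  · have := Gaudin.commute_prodOp (fun i => -y i) 0 0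
      (Gaudin.conjInvariant_w_div_w z₁ ζ₁) (Gaudin.conjInvariant_w_div_w z₂ ζ₂)
      (Gaudin.analyticAt_w_div_w ζ₁ h₁) (Gaudin.analyticAt_w_div_w ζ₂ h₂)
    simpa only [zero_sub, neg_neg] using this
  · obtain ⟨i₁, a₁⟩ := Gaudin.classFunctions_invariant_analytic hf₁
    obtain ⟨i₂, a₂⟩ := Gaudin.classFunctions_invariant_analytic hf₂
    exact Gaudin.commute_gaudinOp xs x x' i₁ i₂ (a₁ h) (a₂ h)
  · exact Gaudin.commute_gaudinOp xs x x' (Gaudin.conjInvariant_schurCharacter lam)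
      (Gaudin.conjInvariant_schurCharacter mu) (Gaudin.analyticAt_schurCharacter lam h)
      (Gaudin.analyticAt_schurCharacter mu h)
  · rcases Nat.eq_zero_or_pos N with rfl | hN
    -- For `N = 0` the spectrum is empty and does not bound `r` below, but the quantum space has
    -- dimension at most one.
    · exact Gaudin.commute_of_subsingleton _ _
    · have : NeZero N := ⟨hN.ne'⟩
      exact (Gaudin.commute_gaudinOp xs x x' (Gaudin.conjInvariant_masterFunction t)
        (Gaudin.conjInvariant_masterFunction t') (Gaudin.analyticAt_masterFunction hr ht)
        (Gaudin.analyticAt_masterFunction hr ht')).1
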